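/- Let $\Omega\subset\mathbb R^d$ be open, and let $\mathbf D=(D_{i,j})$ and $\mathbf q=(q_i)$ have real entries in $L^\infty(\Omega)$, with $\mathbf D$ symmetric, $\sum_{i,j}D_{i,j}(x)\xi_i\xi_j\ge c_1|\xi|^2$ for all $\xi\in\mathbb R^d$ and a.e. $x\in\Omega$ with some $c_1>0$, and $\nabla\cdot\mathbf q=0$ in the sense of distributions. Let $c_0>0$, $T>0$, and let $A=-\nabla\cdot(\mathbf D\nabla\,\cdot)+\mathbf q\cdot\nabla+c_0$ be the operator in $H=L^2(\Omega)$ with homogeneous Dirichlet boundary condition associated with the form $$a(u,v)=\int_\Omega\Big(\sum_{i,j}D_{i,j}\,\partial_j u\,\partial_i v+\sum_i q_i\,\partial_i u\,v+c_0uv\Big)dx,\qquad u,v\in H^1_0(\Omega),$$ that is, $u\in\mathcal D(A)$ and $Au=f$ if and only if $u\in H_0^1(\Omega)$, $f\in L^2(\Omega)$ and $a(u,v)=(f,v)$ for all $v\in H^1_0(\Omega)$. Write $\|\cdot\|$ for the norm of $L^2(\Omega)$ and $\|u\|_2=\|Au\|$ for $u\in\mathcal D(A)$. Then $-A$ is the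 infinitesimal generator of a strongly continuous semigroup $S(t)=e^{-tA}$ on $L^2(\Omega)$. For $R:[0,T]\times L^2(\Omega)\to L^2(\Omega)$ and $X_0\in L^2(\Omega)$, a mild solution of $X'+AX=R(t,X)$, $X(0)=X_0$, is a function $X\in C([0,T];L^2(\Omega))$ with $$X(t)=S(t)X_0+\int_0^tS(t-s)R(s,X(s))\,ds,\qquad t\in[0,T],$$ where the integrals are assumed to exist (as Bochner integrals). The following hold. (i) For every $\epsilon\in(0,1/2)$ there is a constant $C>0$, depending only on $\epsilon$, $T$ and $A$, such that for every $R$, every $X_0\in\mathcal D(A)$ and every mild solution $X$ with $\sup_{0\le s\le T}\|R(s,X(s))\|<\infty$, and for all $0\le t_1<t_2\le T$, $$\|X(t_2)-X(t_1)\|\le C\,(t_2-t_1)^{1-\epsilon}\Big(\|X_0\|_2+\sup_{0\le s\le T}\|R(s,X(s))\|\Big).$$ (ii) For every $L\ge0$ there is a constant $C>0$, depending only on $L$, $T$ and $A$, such that if $K\ge 0$ and $$\|R(s,Y)-R(t,Z)\|\le L\|Y-Z\|+K|s-t|\qquad\text{for all }s,t\in[0,T],\ Y,Z\in L^2(\Omega),$$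 then for every $X_0\in\mathcal D(A)$, every mild solution $X$ and all $0\le t_1<t_2\le T$, $$\|X(t_2)-X(t_1)\|\le C\,(t_2-t_1)\Big(\|X_0\|_2+\sup_{0\le s\le T}\|R(s,X(s))\|+K\Big).$$ In particular, if $R=R(X)$ does not depend explicitly on time and $\|R(Y)-R(Z)\|\le L\|Y-Z\|$ for all $Y,Z\in L^2(\Omega)$, then $$\|X(t_2)-X(t_1)\|\le C\,(t_2-t_1)\Big(\|X_0\|_2+\sup_{0\le s\le T}\|R(X(s))\|\Big).$$ -/

import Mathlib

open MeasureTheory Set Filter Topology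
open scoped ContDiff

noncomputable section

namespace ADR

/-- Euclidean space `ℝ^d`. -/
abbrev Space (d : ℕ) : Type := EuclideanSpace ℝ (Fin d)

/-- The real Hilbert space `L²(Ω)`. -/
abbrev L2 {d : ℕ} (Ω : Set (Space d)) : Type := Lp ℝ 2 (volume.restrict Ω)

/-- The Hilbert space `L²(Ω) × L²(Ω; ℝ^d)` of pairs `(u, g)`, with norm
`(‖u‖² + ‖g‖²)^{1/2}`. A Sobolev function `u` is represented by the pair `(u, ∇u)`, and the
norm of that pair is the `H¹(Ω)` norm of `u`. -/
abbrev H1Ambient {d : ℕ} (Ω : Set (Space d)) : Type :=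
  WithLp 2 (L2 Ω × Lp (Space d) 2 (volume.restrict Ω))

/-- `φ ∈ C_c^∞(Ω)`. -/
structure IsTestFunction {d : ℕ} (Ω : Set (Space d)) (φ : Space d → ℝ) : Prop where
  smooth : ContDiff ℝ ∞ φ
  compact : HasCompactSupport φ
  support : tsupport φ ⊆ Ω

/-- The linear space of all pairs `(φ, ∇φ)` with `φ ∈ C_c^∞(Ω)`. -/
def testPairs {d : ℕ} (Ω : Set (Space d)) : Submodule ℝ (H1Ambient Ω) where
  carrier := {w | ∃ φ : Space d → ℝ, IsTestFunction Ω φ ∧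
    w.fst =ᵐ[volume.restrict Ω] φ ∧ w.snd =ᵐ[volume.restrict Ω] gradient φ}
  zero_mem' := by
    refine ⟨fun _ => 0, ⟨contDiff_const, HasCompactSupport.zero, ?_⟩, ?_, ?_⟩
    · have h : tsupport (fun _ : Space d => (0 : ℝ)) = ∅ := tsupport_eq_empty_iff.2 rfl
      simp [h]
    · exact Lp.coeFn_zero _ _ _
    · refine (Lp.coeFn_zero _ _ _).trans (Eventually.of_forall fun x => ?_)
      simp [gradient]
  add_mem' := by
    rintro v w ⟨φ, hφ, hv, hv'⟩ ⟨ψ, hψ, hw, hw'⟩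
    refine ⟨φ + ψ, ⟨hφ.smooth.add hψ.smooth, hφ.compact.add hψ.compact,
      (tsupport_add φ ψ).trans (union_subset hφ.support hψ.support)⟩, ?_, ?_⟩
    · exact (Lp.coeFn_add _ _).trans (hv.add hw)
    · refine (Lp.coeFn_add _ _).trans ((hv'.add hw').trans (Eventually.of_forall fun x => ?_))
      have h1 : DifferentiableAt ℝ φ x := (hφ.smooth.differentiable (by simp)) x
      have h2 : DifferentiableAt ℝ ψ x := (hψ.smooth.differentiable (by simp)) x
      simp [gradient, fderiv_add h1 h2]
  smul_mem' := by
    rintro c w ⟨φ, hφ, hw, hw'⟩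
    refine ⟨c • φ, ⟨hφ.smooth.const_smul c, hφ.compact.smul_left (f := fun _ => c),
      (closure_mono (Function.support_const_smul_subset c φ)).trans hφ.support⟩, ?_, ?_⟩
    · exact (Lp.coeFn_smul _ _).trans (hw.const_smul c)
    · refine (Lp.coeFn_smul _ _).trans ((hw'.const_smul c).trans
        (Eventually.of_forall fun x => ?_))
      have h1 : DifferentiableAt ℝ φ x := (hφ.smooth.differentiable (by simp)) x
      simp [gradient, fderiv_const_smul h1 c]

/-- `V = H¹₀(Ω)`, the closure of `C_c^∞(Ω)` in the `H¹` norm; its elements are the pairs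
`(u, ∇u)`. -/
def H10 {d : ℕ} (Ω : Set (Space d)) : Submodule ℝ (H1Ambient Ω) :=
  (testPairs Ω).topologicalClosure

/-- `∇ · q = 0` in `Ω`, in the sense of distributions. -/
def IsDivergenceFree {d : ℕ} (Ω : Set (Space d)) (q : Space d → Space d) : Prop :=
  ∀ φ : Space d → ℝ, IsTestFunction Ω φ → ∫ x in Ω, ∑ i, q x i * gradient φ x i = 0

/-- The shifted bilinear form
`a(u, v) = ∫_Ω (∑_{i,j} D_{ij} ∂_j u ∂_i v + ∑_i q_i ∂_i u v + c₀ u v) dx`,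
evaluated at `u = w.fst`, `∇u = w.snd`, `v = z.fst`, `∇v = z.snd`. -/
def form {d : ℕ} (Ω : Set (Space d)) (D : Space d → Matrix (Fin d) (Fin d) ℝ)
    (q : Space d → Space d) (c₀ : ℝ) (w z : H1Ambient Ω) : ℝ :=
  ∫ x in Ω, ((∑ i, ∑ j, D x i j * w.snd x j * z.snd x i)
    + (∑ i, q x i * w.snd x i) * z.fst x + c₀ * w.fst x * z.fst x)

/-- `u ∈ D(A)` and `A u = f`, where `A = -∇·(D∇·) + q·∇ + c₀` with homogeneous Dirichlet boundary
condition is the operator in `L²(Ω)` associated with the form `a` on `H¹₀(Ω)`: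
`u ∈ H¹₀(Ω)` and `a(u, v) = (f, v)` for all `v ∈ H¹₀(Ω)`. -/
def OperatorEq {d : ℕ} (Ω : Set (Space d)) (D : Space d → Matrix (Fin d) (Fin d) ℝ)
    (q : Space d → Space d) (c₀ : ℝ) (u f : L2 Ω) : Prop :=
  ∃ w ∈ H10 Ω, w.fst = u ∧ ∀ z ∈ H10 Ω, form Ω D q c₀ w z = inner ℝ f z.fst

/-- A strongly continuous semigroup `(S(t))_{t ≥ 0}` of bounded operators; the values at negative
times are irrelevant. -/
structure IsC0Semigroup {H : Type*} [NormedAddCommGroup H] [NormedSpace ℝ H]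
    (S : ℝ → H →L[ℝ] H) : Prop where
  zero : S 0 = ContinuousLinearMap.id ℝ H
  add : ∀ s t, 0 ≤ s → 0 ≤ t → S (s + t) = (S s).comp (S t)
  continuousOn : ∀ x : H, ContinuousOn (fun t => S t x) (Ici 0)

/-- `S(t) = e^{-tA}`: `S` is the strongly continuous semigroup on `L²(Ω)` whose infinitesimal
generator (with its exact domain) is `-A`. -/
structure IsSemigroupOf {d : ℕ} (Ω : Set (Space d)) (D : Space d → Matrix (Fin d) (Fin d) ℝ)
    (q : Space d → Space d) (c₀ : ℝ) (S : ℝ → L2 Ω →L[ℝ] L2 Ω) : Prop where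
  semigroup : IsC0Semigroup S
  generator : ∀ u f : L2 Ω, OperatorEq Ω D q c₀ u f ↔
    Tendsto (fun h : ℝ => h⁻¹ • (S h u - u)) (𝓝[>] 0) (𝓝 (-f))

/-- `X ∈ C([0,T]; H)` is a mild solution of `X' + A X = R(t, X)`, `X(0) = X₀`:
`X(t) = S(t) X₀ + ∫₀ᵗ S(t-s) R(s, X(s)) ds` for `t ∈ [0,T]`. -/
structure IsMildSolution {H : Type*} [NormedAddCommGroup H] [NormedSpace ℝ H]
    (S : ℝ → H →L[ℝ] H) (R : ℝ → H → H) (T : ℝ) (X₀ : H) (X : ℝ → H) : Prop where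
  continuousOn : ContinuousOn X (Icc 0 T)
  integrable : ∀ t ∈ Icc 0 T, IntervalIntegrable (fun s => S (t - s) (R s (X s))) volume 0 t
  eq : ∀ t ∈ Icc 0 T, X t = S t X₀ + ∫ s in (0 : ℝ)..t, S (t - s) (R s (X s))

end ADR

end

/-! Since ∇·q = 0, the drift is skew on H¹₀(Ω). The form is therefore coercive, A is m-accretive by
Lax–Milgram, and Hille–Yosida gives the semigroup. The estimates concern any S generated by -A. They
rest on ‖S(t)x‖ ≤ ‖x‖, on ‖S(t)u - u‖ ≤ t‖Au‖ for u ∈ D(A), and on the smoothing bound ‖S(t+h)x -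
S(t)x‖ ≤ C(h/t)‖x‖. The last comes from a real energy argument (`norm_generator_apply_le`),
available because the form is symmetric up to a drift bounded from H¹₀ to L².

For (i), put δ = t₂ - t₁. The increment of X consists of (S(t₂) - S(t₁))X₀, an integral over
[t₁,t₂], and an integral over [0,t₁] of (S(t₂-s) - S(t₁-s))R. The first two are O(δ). In the third,
smoothing gives the non-integrable kernel δ/(t₁-s); interpolating with contractivity replaces it by
(δ/(t₁-s))^(1-ε), which costs the ε.

For (ii), a change of variable moves the time increment from S onto R, so that no singular kernel
appears, and the Lipschitz bound with Grönwall's inequality closes the estimate. The autonomous case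
is K = 0. -/

namespace ADR

open NormedSpace

/-! ### Bounded dissipative operators and Yosida approximations. -/

section HilleYosida

variable {H : Type*} [NormedAddCommGroup H] [InnerProductSpace ℝ H]

/-- A function on `[0, t]` with nonpositive right derivative is below its initial value. -/
theorem le_initial_of_deriv_right_nonpos {f f' : ℝ → ℝ} {t : ℝ} (ht : 0 ≤ t)
    (hf : ContinuousOn f (Icc 0 t))
    (hf' : ∀ x ∈ Ico 0 t, HasDerivWithinAt f (f' x) (Ici x) x)
    (h : ∀ x ∈ Ico 0 t, f' x ≤ 0) : f t ≤ f 0 :=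
  image_le_of_deriv_right_le_deriv_boundary (B := fun _ => f 0) (B' := fun _ => 0)
    hf hf' le_rfl continuousOn_const
    (fun x _ => hasDerivWithinAt_const x (Ici x) (f 0)) h (right_mem_Icc.2 ht)

/-- The exponential of a bounded dissipative operator is a contraction. -/
theorem norm_exp_smul_apply_le [CompleteSpace H] {a : H →L[ℝ] H}
    (ha : ∀ x, inner ℝ (a x) x ≤ 0) {t : ℝ} (ht : 0 ≤ t) (x : H) :
    ‖exp (t • a) x‖ ≤ ‖x‖ := by
  have hd : ∀ s : ℝ, HasDerivAt (fun s : ℝ => exp (s • a) x) (a (exp (s • a) x)) s := fun s => by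
    simpa using (hasDerivAt_exp_smul_const' a s).clm_apply (hasDerivAt_const s x)
  have hd2 : ∀ s : ℝ, HasDerivAt (fun s : ℝ => ‖exp (s • a) x‖ ^ 2)
      (2 * inner ℝ (exp (s • a) x) (a (exp (s • a) x))) s := fun s => (hd s).norm_sq
  have h := le_initial_of_deriv_right_nonpos ht
    (fun s _ => (hd2 s).continuousAt.continuousWithinAt)
    (fun s _ => (hd2 s).hasDerivWithinAt) (fun s _ => by
      have := ha (exp (s • a) x)
      rw [real_inner_comm] at this
      linarith)
  simp only [zero_smul, exp_zero, one_apply_eq_self] at h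
  exact (sq_le_sq₀ (norm_nonneg _) (norm_nonneg _)).1 h

/-- Two commuting bounded dissipative operators generate nearby semigroups. -/
theorem norm_exp_smul_apply_sub_le [CompleteSpace H] {a b : H →L[ℝ] H}
    (ha : ∀ x, inner ℝ (a x) x ≤ 0) (hb : ∀ x, inner ℝ (b x) x ≤ 0) (hab : Commute a b)
    {t : ℝ} (ht : 0 ≤ t) (x : H) :
    ‖exp (t • a) x - exp (t • b) x‖ ≤ t * ‖a x - b x‖ := by
  -- This path joins exp(tb)x to exp(ta)x. Commutation brings a - b next to x, and the two
  -- contractions then bound the speed by ‖ax - bx‖.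
  have hd : ∀ s : ℝ, HasDerivAt (fun s : ℝ => (exp ((t - s) • b) * exp (s • a)) x)
      ((exp ((t - s) • b) * exp (s • a)) (a x - b x)) s := fun s => by
    have h1 : HasDerivAt (fun s : ℝ => exp ((t - s) • b)) (-(exp ((t - s) • b) * b)) s := by
      convert! (hasDerivAt_exp_smul_const b (t - s)).scomp s ((hasDerivAt_id s).const_sub t) using 1
      simp
    have h2 := hasDerivAt_exp_smul_const a s
    have h3 := (h1.mul h2).clm_apply (hasDerivAt_const s x)
    have hc : b * exp (s • a) = exp (s • a) * b :=
      ((hab.symm.smul_right s).exp_right).eq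
    convert! h3 using 1
    rw [neg_mul, mul_assoc, hc]
    simp only [mul_apply_eq_comp, map_sub, _root_.add_apply,
      _root_.neg_apply, map_zero, add_zero]
    abel
  have h := norm_image_sub_le_of_norm_deriv_le_segment' (a := 0) (b := t)
    (fun s _ => (hd s).hasDerivWithinAt) (C := ‖a x - b x‖) (fun s hs => by
      exact (norm_exp_smul_apply_le hb (sub_nonneg.2 hs.2.le) _).trans
        (norm_exp_smul_apply_le ha hs.1 _)) t (right_mem_Icc.2 ht)
  simpa [mul_comm] using h

/-- The graph of a densely defined m-accretive operator. -/
structure IsMAccretive (G : Submodule ℝ (H × H)) : Prop where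
  accretive : ∀ p ∈ G, 0 ≤ inner ℝ p.2 p.1
  exists_resolvent : ∀ l : ℝ, 0 < l → ∀ g : H, ∃ p ∈ G, l • p.1 + p.2 = g
  dense : Dense {u : H | ∃ f, (u, f) ∈ G}

namespace IsMAccretive

variable {G : Submodule ℝ (H × H)}

/-- In the expanded square of the right side, the cross term is nonnegative by accretivity. This
yields both uniqueness for the resolvent equation and boundedness of the Yosida approximation. -/
theorem norm_snd_le (hG : IsMAccretive G)
    {l : ℝ} (hl : 0 < l) {p : H × H} (hp : p ∈ G) :
    ‖p.2‖ ≤ ‖l • p.1 + p.2‖ := by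
  have h1 : ‖l • p.1 + p.2‖ ^ 2 = l ^ 2 * ‖p.1‖ ^ 2 + 2 * (l * inner ℝ p.2 p.1) + ‖p.2‖ ^ 2 := by
    rw [norm_add_sq_real, norm_smul, inner_smul_left, real_inner_comm, mul_pow]
    simp
  have h2 := mul_nonneg hl.le (hG.accretive p hp)
  refine (sq_le_sq₀ (norm_nonneg _) (norm_nonneg _)).1 ?_
  rw [h1]
  have : 0 ≤ l ^ 2 * ‖p.1‖ ^ 2 := by positivity
  linarith

theorem snd_eq (hG : IsMAccretive G)
    {l : ℝ} (hl : 0 < l) {p p' : H × H} (hp : p ∈ G) (hp' : p' ∈ G)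
    (h : l • p.1 + p.2 = l • p'.1 + p'.2) : p.2 = p'.2 := by
  have h1 := hG.norm_snd_le hl (G.sub_mem hp hp')
  have h2 : l • (p - p').1 + (p - p').2 = 0 := by
    rw [← sub_eq_zero] at h
    rw [← h]
    simp only [Prod.fst_sub, Prod.snd_sub, smul_sub]
    abel
  rw [h2, norm_zero] at h1
  exact sub_eq_zero.1 (norm_le_zero_iff.1 h1)

/-- The Yosida approximation: `A_l g = A (1 + A / l)⁻¹ g`. -/
theorem exists_yosida (hG : IsMAccretive G)
    {l : ℝ} (hl : 0 < l) :
    ∃ A : H →L[ℝ] H, ∀ g, (g - l⁻¹ • A g, A g) ∈ G := by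
  -- The first component of p g is (1 + A/l)⁻¹g and the second is A_l g. Linearity follows from
  -- uniqueness, `snd_eq`.
  choose p hp hpe using fun g => hG.exists_resolvent l hl (l • g)
  have hadd : ∀ x y, (p (x + y)).2 = (p x).2 + (p y).2 := fun x y => by
    refine hG.snd_eq hl (hp _) (G.add_mem (hp x) (hp y)) ?_
    rw [hpe, smul_add, ← hpe x, ← hpe y]
    simp only [Prod.fst_add, Prod.snd_add, smul_add]
    abel
  have hsmul : ∀ (c : ℝ) x, (p (c • x)).2 = c • (p x).2 := fun c x => by
    refine hG.snd_eq hl (hp _) (G.smul_mem c (hp x)) ?_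
    rw [hpe, smul_comm, ← hpe x]
    simp only [Prod.smul_fst, Prod.smul_snd, smul_add]
    rw [smul_comm]
  refine ⟨LinearMap.mkContinuous ⟨⟨fun g => (p g).2, hadd⟩, hsmul⟩ l fun g => ?_, fun g => ?_⟩
  · refine (hG.norm_snd_le hl (hp g)).trans ?_
    rw [hpe, norm_smul, Real.norm_of_nonneg hl.le]
  · have : g - l⁻¹ • (p g).2 = (p g).1 := by
      have h := congrArg (fun z => l⁻¹ • z) (hpe g)
      simp only [smul_add, smul_smul, inv_mul_cancel₀ hl.ne', one_smul] at h
      exact (eq_sub_of_add_eq h).symm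
    change (g - l⁻¹ • (p g).2, (p g).2) ∈ G
    rw [this]
    exact hp g

theorem yosida_eq (hG : IsMAccretive G) {l : ℝ} (hl : 0 < l) {A : H →L[ℝ] H}
    (hA : ∀ g, (g - l⁻¹ • A g, A g) ∈ G)
    {p : H × H} (hp : p ∈ G) {g : H} (h : l • p.1 + p.2 = l • g) : p.2 = A g := by
  refine hG.snd_eq hl hp (hA g) ?_
  rw [h, smul_sub, smul_smul, mul_inv_cancel₀ hl.ne', one_smul, sub_add_cancel]

theorem yosida_accretive (hG : IsMAccretive G) {l : ℝ} (hl : 0 < l) {A : H →L[ℝ] H}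
    (hA : ∀ g, (g - l⁻¹ • A g, A g) ∈ G)
    (x : H) : inner ℝ ((-A) x) x ≤ 0 := by
  have h := hG.accretive _ (hA x)
  simp only [inner_sub_right, inner_smul_right, real_inner_self_eq_norm_sq] at h
  have : 0 ≤ l⁻¹ * ‖A x‖ ^ 2 := by positivity
  simp only [_root_.neg_apply, inner_neg_left]
  linarith

theorem norm_inv_smul_yosida_le (hG : IsMAccretive G) {l : ℝ} (hl : 0 < l) {A : H →L[ℝ] H}
    (hA : ∀ g, (g - l⁻¹ • A g, A g) ∈ G)
    (x : H) : ‖l⁻¹ • A x‖ ≤ ‖x‖ := by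
  have h := hG.norm_snd_le hl (hA x)
  simp only [smul_sub, smul_smul, mul_inv_cancel₀ hl.ne', one_smul, sub_add_cancel] at h
  rw [norm_smul, Real.norm_of_nonneg hl.le] at h
  rw [norm_smul, norm_inv, Real.norm_of_nonneg hl.le, inv_mul_le_iff₀ hl]
  exact h

/-- The resolvent commutes with A on its domain: (x, f) minus the resolvent pair of x solves the
resolvent equation with datum f/l. -/
theorem yosida_eq_sub (hG : IsMAccretive G) {l : ℝ} (hl : 0 < l) {A : H →L[ℝ] H}
    (hA : ∀ g, (g - l⁻¹ • A g, A g) ∈ G)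
    {x f : H} (hx : (x, f) ∈ G) : A x = f - l⁻¹ • A f := by
  have h := hG.yosida_eq hl hA (g := l⁻¹ • f) (G.sub_mem hx (hA x)) (by
    simp only [Prod.fst_sub, Prod.snd_sub, sub_sub_cancel, smul_smul, mul_inv_cancel₀ hl.ne',
      one_smul]
    abel)
  simp only [Prod.snd_sub, map_smul] at h
  rw [← h]; abel

/-- Accretivity of the difference between (x, f) and the resolvent pair of x reads (f - A_l x, A_l
x) ≥ 0; conclude by Cauchy–Schwarz. -/
theorem norm_yosida_le (hG : IsMAccretive G) {l : ℝ} (hl : 0 < l) {A : H →L[ℝ] H}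
    (hA : ∀ g, (g - l⁻¹ • A g, A g) ∈ G)
    {x f : H} (hx : (x, f) ∈ G) : ‖A x‖ ≤ ‖f‖ := by
  have h := hG.accretive _ (G.sub_mem hx (hA x))
  simp only [Prod.fst_sub, Prod.snd_sub, sub_sub_cancel, inner_smul_right, inner_sub_left,
    real_inner_self_eq_norm_sq] at h
  have h' := nonneg_of_mul_nonneg_right h (inv_pos.2 hl)
  have h2 := real_inner_le_norm f (A x)
  by_contra! hlt
  have : 0 < ‖A x‖ := (norm_nonneg _).trans_lt hlt
  nlinarith

theorem yosida_mem (hG : IsMAccretive G) {l : ℝ} (hl : 0 < l) {A : H →L[ℝ] H}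
    (hA : ∀ g, (g - l⁻¹ • A g, A g) ∈ G)
    {x f : H} (hx : (x, f) ∈ G) : (A x, A f) ∈ G := by
  rw [hG.yosida_eq_sub hl hA hx]
  exact hA f

/-- A_l preserves the graph, so it maps the m-resolvent pair of g to that of A_l g. -/
theorem yosida_commute (hG : IsMAccretive G) {l : ℝ} (hl : 0 < l) {A : H →L[ℝ] H}
    (hA : ∀ g, (g - l⁻¹ • A g, A g) ∈ G)
    {m : ℝ} (hm : 0 < m) {A' : H →L[ℝ] H}
    (hA' : ∀ g, (g - m⁻¹ • A' g, A' g) ∈ G) : Commute A A' := by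
  ext g
  have h := hG.yosida_mem hl hA (hA' g)
  exact hG.yosida_eq hm hA' h (by
    simp only [map_sub, map_smul, smul_sub, smul_smul, mul_inv_cancel₀ hm.ne', one_smul]
    abel)

end IsMAccretive

end HilleYosida

/-! ### The semigroup as a strong limit of exponentials. -/

section Generation

variable {H : Type*} [NormedAddCommGroup H] [InnerProductSpace ℝ H] [CompleteSpace H]
  {G : Submodule ℝ (H × H)}

namespace IsMAccretive

/-- **Hille–Yosida theorem**, in a Hilbert space: if `A` is m-accretive with graph `G`, then `-A` is
the generator of a strongly continuous semigroup. -/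
theorem exists_semigroup (hG : IsMAccretive G) :
    ∃ S : ℝ → H →L[ℝ] H, IsC0Semigroup S ∧ ∀ u f : H, (u, f) ∈ G ↔
      Tendsto (fun h : ℝ => h⁻¹ • (S h u - u)) (𝓝[>] 0) (𝓝 (-f)) := by
  have hl : ∀ n : ℕ, (0 : ℝ) < n + 1 := fun n => by positivity
  choose A hA using fun n : ℕ => hG.exists_yosida (hl n)
  have hdiss : ∀ n x, inner ℝ ((-A n) x) x ≤ 0 := fun n => hG.yosida_accretive (hl n) (hA n)
  have hcontr : ∀ n {t : ℝ}, 0 ≤ t → ∀ x, ‖exp (t • -A n) x‖ ≤ ‖x‖ := fun n t ht x =>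
    norm_exp_smul_apply_le (hdiss n) ht x
  have hcomm : ∀ m n, Commute (-A m) (-A n) := fun m n =>
    (hG.yosida_commute (hl m) (hA m) (hl n) (hA n)).neg_left.neg_right
  have hnear : ∀ (x : H) {e : ℝ}, 0 < e → ∃ y f, (y, f) ∈ G ∧ ‖x - y‖ < e := fun x e he => by
    obtain ⟨y, hy, f, hf⟩ := Metric.dense_iff.1 hG.dense x e he
    exact ⟨y, f, hf, by rwa [← dist_eq_norm, dist_comm]⟩
  -- On the domain this is O(1/n); these operators are contractions, so density extends the limit to
  -- all x.
  have hAtend0 : ∀ x, Tendsto (fun n : ℕ => ((n : ℝ) + 1)⁻¹ • A n x) atTop (𝓝 0) := fun x => by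
    rw [Metric.tendsto_atTop]
    intro e he
    obtain ⟨y, f, hf, hy⟩ := hnear x (half_pos he)
    have h0 : Tendsto (fun n : ℕ => ((n : ℝ) + 1)⁻¹ * ‖f‖) atTop (𝓝 0) := by
      simpa using (tendsto_one_div_add_atTop_nhds_zero_nat (𝕜 := ℝ)).mul_const ‖f‖
    obtain ⟨N, hN⟩ := eventually_atTop.1 (h0.eventually (gt_mem_nhds (half_pos he)))
    refine ⟨N, fun n hn => ?_⟩
    rw [dist_zero_right]
    have h1 := hG.norm_inv_smul_yosida_le (hl n) (hA n) (x - y)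
    have h2 : ‖((n : ℝ) + 1)⁻¹ • A n y‖ ≤ ((n : ℝ) + 1)⁻¹ * ‖f‖ := by
      rw [norm_smul, norm_inv, Real.norm_of_nonneg (hl n).le]
      gcongr
      exact hG.norm_yosida_le (hl n) (hA n) hf
    have h3 := norm_add_le (((n : ℝ) + 1)⁻¹ • A n (x - y)) (((n : ℝ) + 1)⁻¹ • A n y)
    rw [← smul_add, ← map_add, sub_add_cancel] at h3
    linarith [hN n hn]
  have hAtend : ∀ {x f}, (x, f) ∈ G → Tendsto (fun n => A n x) atTop (𝓝 f) := fun {x f} hx => by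
    have h := (hAtend0 f).const_sub f
    rw [sub_zero] at h
    refine h.congr fun n => (hG.yosida_eq_sub (hl n) (hA n) hx).symm
  have hcauchy : ∀ {t : ℝ}, 0 ≤ t → ∀ x, CauchySeq fun n => exp (t • -A n) x := fun {t} ht x => by
    rw [Metric.cauchySeq_iff]
    intro e he
    obtain ⟨y, f, hf, hy⟩ := hnear x (show 0 < e / 3 by positivity)
    -- Dividing by t + 1 rather than t covers t = 0.
    have he' : 0 < e / 3 / (t + 1) := by positivity
    obtain ⟨N, hN⟩ := Metric.cauchySeq_iff.1 (hAtend hf).cauchySeq _ he'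
    refine ⟨N, fun m hm n hn => ?_⟩
    have h1 := norm_exp_smul_apply_sub_le (hdiss m) (hdiss n) (hcomm m n) ht y
    have h2 : ‖(-A m) y - (-A n) y‖ < e / 3 / (t + 1) := by
      rw [_root_.neg_apply, _root_.neg_apply, neg_sub_neg, ← dist_eq_norm, dist_comm]
      exact hN m hm n hn
    have h3 : t * ‖(-A m) y - (-A n) y‖ ≤ e / 3 := by
      calc _ ≤ (t + 1) * (e / 3 / (t + 1)) := by gcongr; linarith
        _ = e / 3 := by field_simp
    have h4 := hcontr m ht (x - y)
    have h5 := hcontr n ht (x - y)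
    rw [map_sub] at h4 h5
    rw [dist_eq_norm, show exp (t • -A m) x - exp (t • -A n) x
      = (exp (t • -A m) x - exp (t • -A m) y) + (exp (t • -A m) y - exp (t • -A n) y)
        - (exp (t • -A n) x - exp (t • -A n) y) by abel]
    refine (norm_sub_le _ _).trans_lt ?_
    have := norm_add_le (exp (t • -A m) x - exp (t • -A m) y)
      (exp (t • -A m) y - exp (t • -A n) y)
    linarith
  -- Truncation at 0 makes the limit exist for every real t; negative times are irrelevant.
  -- Boundedness of the limit operator is Banach–Steinhaus.
  choose F hF using fun (t : ℝ) (x : H) =>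
    cauchySeq_tendsto_of_complete (hcauchy (le_max_right t 0) x)
  have hlim : ∀ t : ℝ, Tendsto (fun n x => exp (max t 0 • -A n) x) atTop (𝓝 (F t)) := fun t =>
    tendsto_pi_nhds.2 (hF t)
  let S : ℝ → H →L[ℝ] H := fun t => continuousLinearMapOfTendsto _ (hlim t)
  have hS : ∀ {t : ℝ}, 0 ≤ t → ∀ x, Tendsto (fun n => exp (t • -A n) x) atTop (𝓝 (S t x)) :=
    fun {t} ht x => by
      have := hF t x
      rwa [max_eq_left ht] at this
  have hSc : ∀ {t : ℝ}, 0 ≤ t → ∀ x, ‖S t x‖ ≤ ‖x‖ := fun {t} ht x =>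
    le_of_tendsto (hS ht x).norm (Eventually.of_forall fun n => hcontr n ht x)
  have hzero : S 0 = ContinuousLinearMap.id ℝ H := by
    ext x
    refine tendsto_nhds_unique (hS le_rfl x) ?_
    simp
  have hadd : ∀ s t, 0 ≤ s → 0 ≤ t → S (s + t) = (S s).comp (S t) := fun s t hs ht => by
    ext x
    refine tendsto_nhds_unique (hS (add_nonneg hs ht) x) ?_
    have h1 : Tendsto (fun n => exp (s • -A n) (exp (t • -A n) x - S t x)) atTop (𝓝 0) := by
      refine squeeze_zero_norm (fun n => hcontr n hs _) ?_
      simpa using ((hS ht x).sub_const (S t x)).norm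
    have h2 := h1.add (hS hs (S t x))
    rw [zero_add] at h2
    refine h2.congr fun n => ?_
    let _ : NormedAlgebra ℚ (H →L[ℝ] H) := NormedAlgebra.restrictScalars ℚ ℝ _
    rw [← map_add, sub_add_cancel, add_smul,
      exp_add_of_commute (((Commute.refl (-A n)).smul_left s).smul_right t)]
    rfl
  have hLip : ∀ {x f}, (x, f) ∈ G → ∀ {t : ℝ}, 0 ≤ t → ‖S t x - x‖ ≤ t * ‖f‖ :=
    fun {x f} hx {t} ht => by
      refine le_of_tendsto ((hS ht x).sub_const x).norm (Eventually.of_forall fun n => ?_)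
      have h := norm_exp_smul_apply_sub_le (b := 0) (hdiss n) (by simp) (Commute.zero_right _) ht x
      simp only [smul_zero, exp_zero, one_apply_eq_self, _root_.neg_apply, _root_.zero_apply,
        sub_zero, norm_neg] at h
      exact h.trans (by gcongr; exact hG.norm_yosida_le (hl n) (hA n) hx)
  have hLip' : ∀ x {y f}, (y, f) ∈ G → ∀ {t : ℝ}, 0 ≤ t →
      ‖S t x - x‖ ≤ 2 * ‖x - y‖ + t * ‖f‖ := fun x y f hy t ht => by
    have h1 := hSc ht (x - y)
    have h2 := hLip hy ht
    rw [map_sub] at h1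
    have h3 : S t x - x = (S t x - S t y) + (S t y - y) - (x - y) := by abel
    rw [h3]
    have h4 := norm_sub_le ((S t x - S t y) + (S t y - y)) (x - y)
    have h5 := norm_add_le (S t x - S t y) (S t y - y)
    linarith
  have hright : ∀ x, Tendsto (fun h : ℝ => S h x - x) (𝓝[≥] 0) (𝓝 0) := fun x => by
    rw [Metric.tendsto_nhds]
    intro e he
    obtain ⟨y, f, hf, hy⟩ := hnear x (show 0 < e / 4 by positivity)
    have h0 : Tendsto (fun t : ℝ => t * ‖f‖) (𝓝[≥] 0) (𝓝 0) := by
      have : Tendsto (fun t : ℝ => t * ‖f‖) (𝓝 0) (𝓝 (0 * ‖f‖)) := tendsto_id.mul_const _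
      rw [zero_mul] at this
      exact this.mono_left nhdsWithin_le_nhds
    filter_upwards [h0.eventually (gt_mem_nhds (half_pos he)), self_mem_nhdsWithin] with t ht ht0
    rw [dist_zero_right]
    linarith [hLip' x hf ht0]
  have hdiff : ∀ x {s t : ℝ}, 0 ≤ s → s ≤ t → ‖S t x - S s x‖ ≤ ‖S (t - s) x - x‖ :=
    fun x s t hs hst => by
      have h := hadd s (t - s) hs (sub_nonneg.2 hst)
      rw [add_sub_cancel] at h
      rw [h, ContinuousLinearMap.comp_apply, ← map_sub]
      exact hSc hs _
  have hcont : ∀ x : H, ContinuousOn (fun t => S t x) (Ici 0) := fun x => by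
    intro t ht
    rw [ContinuousWithinAt, tendsto_iff_norm_sub_tendsto_zero]
    have h1 : Tendsto (fun s : ℝ => |s - t|) (𝓝[Ici 0] t) (𝓝[≥] 0) := by
      refine tendsto_nhdsWithin_iff.2 ⟨?_, Eventually.of_forall fun s => mem_Ici.2 (abs_nonneg _)⟩
      have : Continuous fun s : ℝ => |s - t| := by fun_prop
      simpa using (this.tendsto t).mono_left nhdsWithin_le_nhds
    refine squeeze_zero' (Eventually.of_forall fun s => norm_nonneg _) ?_
      (by simpa using ((hright x).comp h1).norm)
    filter_upwards [self_mem_nhdsWithin] with s hs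
    rcases le_total t s with h | h
    · simpa [abs_of_nonneg (sub_nonneg.2 h)] using hdiff x ht h
    · rw [norm_sub_rev, abs_sub_comm, abs_of_nonneg (sub_nonneg.2 h)]
      exact hdiff x hs h
  have hgen : ∀ u f : H, (u, f) ∈ G →
      Tendsto (fun h : ℝ => h⁻¹ • (S h u - u)) (𝓝[>] 0) (𝓝 (-f)) := fun u f hu => by
    -- Since f = Au need not lie in the domain, it is approximated by y that does. The derivative f
    -- - exp(-sA_n)A_n u is then bounded uniformly in n, up to A_n u - f → 0.
    have hest : ∀ {y g}, (y, g) ∈ G → ∀ {t : ℝ}, 0 ≤ t →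
        ‖S t u - u + t • f‖ ≤ t * (2 * ‖f - y‖ + t * ‖g‖) := fun {y g} hy {t} ht => by
      have hd : ∀ n s, HasDerivAt (fun s : ℝ => exp (s • -A n) u + s • f)
          (exp (s • -A n) ((-A n) u) + f) s := fun n s => by
        convert! ((hasDerivAt_exp_smul_const (-A n) s).clm_apply (hasDerivAt_const s u)).add
          ((hasDerivAt_id s).smul_const f) using 1
        simp
      have hn : ∀ n, ‖exp (t • -A n) u - u + t • f‖
          ≤ (‖A n u - f‖ + 2 * ‖f - y‖ + t * ‖g‖) * t := fun n => by
        have h := norm_image_sub_le_of_norm_deriv_le_segment' (a := 0) (b := t)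
          (fun s _ => (hd n s).hasDerivWithinAt)
          (C := ‖A n u - f‖ + 2 * ‖f - y‖ + t * ‖g‖) (fun s hs => ?_) t (right_mem_Icc.2 ht)
        · have e : exp (t • -A n) u - u + t • f = exp (t • -A n) u + t • f - u := by abel
          rw [e]
          simpa using h
        · have h1 := hcontr n hs.1 (A n u - f)
          have h2 := hcontr n hs.1 (f - y)
          have h3 := norm_exp_smul_apply_sub_le (b := 0) (hdiss n) (by simp)
            (Commute.zero_right _) hs.1 y
          simp only [smul_zero, exp_zero, one_apply_eq_self, _root_.neg_apply, _root_.zero_apply,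
            sub_zero, norm_neg] at h3
          have h4 : s * ‖A n y‖ ≤ t * ‖g‖ := by
            gcongr
            · exact hs.2.le
            · exact hG.norm_yosida_le (hl n) (hA n) hy
          have e : exp (s • -A n) ((-A n) u) + f = -(exp (s • -A n) (A n u - f))
              - exp (s • -A n) (f - y) - (exp (s • -A n) y - y) + (f - y) := by
            simp only [_root_.neg_apply, map_neg, map_sub]
            abel
          rw [e]
          refine (norm_add_le _ _).trans ?_
          have h5 := norm_sub_le (-(exp (s • -A n) (A n u - f)) - exp (s • -A n) (f - y))
            (exp (s • -A n) y - y)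
          have h6 := norm_sub_le (-(exp (s • -A n) (A n u - f))) (exp (s • -A n) (f - y))
          rw [norm_neg] at h6
          linarith
      have hr : Tendsto (fun n => (‖A n u - f‖ + 2 * ‖f - y‖ + t * ‖g‖) * t) atTop
          (𝓝 ((‖f - f‖ + 2 * ‖f - y‖ + t * ‖g‖) * t)) :=
        (((((hAtend hu).sub_const f).norm).add_const _).add_const _).mul_const t
      have h := le_of_tendsto_of_tendsto' (((hS ht u).sub_const u).add_const (t • f)).norm hr hn
      rw [sub_self, norm_zero, zero_add] at h
      linarith
    rw [Metric.tendsto_nhds]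
    intro e he
    obtain ⟨y, g, hy, hfy⟩ := hnear f (show 0 < e / 4 by positivity)
    have h0 : Tendsto (fun t : ℝ => t * ‖g‖) (𝓝[>] 0) (𝓝 0) := by
      have : Tendsto (fun t : ℝ => t * ‖g‖) (𝓝 0) (𝓝 (0 * ‖g‖)) := tendsto_id.mul_const _
      rw [zero_mul] at this
      exact this.mono_left nhdsWithin_le_nhds
    filter_upwards [h0.eventually (gt_mem_nhds (half_pos he)), self_mem_nhdsWithin] with t ht ht0
    have ht0' : 0 < t := ht0
    have h := hest hy ht0'.le
    rw [dist_eq_norm, show t⁻¹ • (S t u - u) - -f = t⁻¹ • (S t u - u + t • f) by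
      rw [smul_add, smul_smul, inv_mul_cancel₀ ht0'.ne', one_smul]; abel,
      norm_smul, norm_inv, Real.norm_of_nonneg ht0'.le, inv_mul_lt_iff₀ ht0']
    refine h.trans_lt (mul_lt_mul_of_pos_left ?_ ht0')
    linarith
  refine ⟨S, ⟨hzero, hadd, hcont⟩, fun u f => ⟨hgen u f, fun h => ?_⟩⟩
  -- For the converse, solve v + Av = u + f. The orbit of u - v has initial velocity u - v, whereas
  -- contractivity forces (velocity, u - v) ≤ 0; hence u = v.
  obtain ⟨⟨v, k⟩, hvk, he⟩ := hG.exists_resolvent 1 one_pos (u + f)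
  simp only [one_smul] at he
  have h1 := h.sub (hgen v k hvk)
  have h2 : Tendsto (fun h : ℝ => inner ℝ (h⁻¹ • (S h (u - v) - (u - v))) (u - v)) (𝓝[>] 0)
      (𝓝 (inner ℝ (u - v) (u - v))) := by
    have e : -f - -k = u - v := by
      rw [sub_neg_eq_add, neg_add_eq_sub, sub_eq_sub_iff_add_eq_add, add_comm k, he]
    rw [e] at h1
    refine (h1.inner tendsto_const_nhds).congr fun t => ?_
    congr 1
    rw [map_sub, ← smul_sub]
    congr 1
    abel
  have h3 : inner ℝ (u - v) (u - v) ≤ (0 : ℝ) := by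
    refine le_of_tendsto h2 ?_
    filter_upwards [self_mem_nhdsWithin] with t ht
    have ht' : (0 : ℝ) < t := ht
    rw [real_inner_smul_left, inner_sub_left, real_inner_self_eq_norm_sq]
    have a1 := real_inner_le_norm (S t (u - v)) (u - v)
    have a2 := hSc ht'.le (u - v)
    have a3 : inner ℝ (S t (u - v)) (u - v) - ‖u - v‖ ^ 2 ≤ 0 := by
      nlinarith [norm_nonneg (u - v)]
    exact mul_nonpos_of_nonneg_of_nonpos (by positivity) a3
  have h4 : u = v := sub_eq_zero.1 (by simpa using h3)
  subst h4
  rwa [← add_left_cancel he]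

end IsMAccretive

end Generation

/-! ### Contractivity and Lipschitz orbits for any semigroup with an accretive generator. -/

section Orbits

variable {H : Type*} [NormedAddCommGroup H] [InnerProductSpace ℝ H]

/-- `S` is a strongly continuous semigroup whose generator is `-A`, where `A` is the densely defined
accretive operator with graph `G`. -/
structure IsAccretiveSemigroup (G : Submodule ℝ (H × H)) (S : ℝ → H →L[ℝ] H) : Prop
    extends IsC0Semigroup S where
  accretive : ∀ p ∈ G, 0 ≤ inner ℝ p.2 p.1
  dense : Dense {u : H | ∃ f, (u, f) ∈ G}
  generator : ∀ u f : H, (u, f) ∈ G ↔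
    Tendsto (fun h : ℝ => h⁻¹ • (S h u - u)) (𝓝[>] 0) (𝓝 (-f))

namespace IsAccretiveSemigroup

variable {G : Submodule ℝ (H × H)} {S : ℝ → H →L[ℝ] H}

theorem add_apply (hS : IsAccretiveSemigroup G S)
    {s t : ℝ} (hs : 0 ≤ s) (ht : 0 ≤ t) (x : H) : S (s + t) x = S s (S t x) := by
  rw [hS.add s t hs ht, ContinuousLinearMap.comp_apply]

theorem continuousOn_Icc (hS : IsAccretiveSemigroup G S)
    (x : H) (t : ℝ) : ContinuousOn (fun s => S s x) (Icc 0 t) :=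
  (hS.continuousOn x).mono Icc_subset_Ici_self

theorem mem_graph (hS : IsAccretiveSemigroup G S)
    {u f : H} (hu : (u, f) ∈ G) {t : ℝ} (ht : 0 ≤ t) : (S t u, S t f) ∈ G := by
  rw [hS.generator, ← map_neg]
  refine (((S t).continuous.tendsto _).comp ((hS.generator u f).1 hu)).congr' ?_
  filter_upwards [self_mem_nhdsWithin] with h hh
  rw [Function.comp_apply, map_smul, map_sub, ← hS.add_apply ht (le_of_lt hh),
    ← hS.add_apply (le_of_lt hh) ht, add_comm]

/-- The right derivative follows directly from the semigroup law, and the monotonicity and mean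
value arguments need no more. -/
theorem hasDerivWithinAt (hS : IsAccretiveSemigroup G S)
    {u f : H} (hu : (u, f) ∈ G) {t : ℝ} (ht : 0 ≤ t) :
    HasDerivWithinAt (fun s => S s u) (-(S t f)) (Ici t) t := by
  rw [← hasDerivWithinAt_Ioi_iff_Ici, hasDerivWithinAt_iff_tendsto_slope' self_notMem_Ioi,
    ← map_neg]
  have hsub : Tendsto (fun s : ℝ => s - t) (𝓝[>] t) (𝓝[>] 0) := by
    refine tendsto_nhdsWithin_iff.2 ⟨?_, ?_⟩
    · have : Continuous fun s : ℝ => s - t := by fun_prop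
      simpa using (this.tendsto t).mono_left nhdsWithin_le_nhds
    · filter_upwards [self_mem_nhdsWithin] with s hs
      exact sub_pos.2 (mem_Ioi.1 hs)
  refine (((S t).continuous.tendsto _).comp (((hS.generator u f).1 hu).comp hsub)).congr' ?_
  filter_upwards [self_mem_nhdsWithin] with s hs
  have h := hS.add_apply ht (sub_nonneg.2 (le_of_lt (mem_Ioi.1 hs))) u
  rw [add_sub_cancel] at h
  rw [slope_def_module, h, Function.comp_apply, Function.comp_apply, map_smul, map_sub]

/-- Contractivity is not assumed of S: it comes from d/ds ‖S(s)u‖² = -2(AS(s)u, S(s)u) ≤ 0. -/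
theorem norm_apply_le_of_mem (hS : IsAccretiveSemigroup G S)
    {u f : H} (hu : (u, f) ∈ G) {t : ℝ} (ht : 0 ≤ t) :
    ‖S t u‖ ≤ ‖u‖ := by
  have h := le_initial_of_deriv_right_nonpos (f := fun s => ‖S s u‖ ^ 2) ht
    ((hS.continuousOn_Icc u t).norm.pow 2)
    (fun s hs => (hS.hasDerivWithinAt hu hs.1).norm_sq) (fun s hs => by
      have := hS.accretive _ (hS.mem_graph hu hs.1)
      rw [real_inner_comm] at this
      rw [inner_neg_right]
      linarith)
  simp only [hS.zero, ContinuousLinearMap.id_apply] at h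
  exact (sq_le_sq₀ (norm_nonneg _) (norm_nonneg _)).1 h

theorem norm_apply_le (hS : IsAccretiveSemigroup G S)
    {t : ℝ} (ht : 0 ≤ t) (x : H) : ‖S t x‖ ≤ ‖x‖ := by
  refine hS.dense.induction (P := fun x => ‖S t x‖ ≤ ‖x‖)
    (fun u ⟨f, hu⟩ => hS.norm_apply_le_of_mem hu ht) ?_ x
  exact isClosed_le (by fun_prop) (by fun_prop)

theorem norm_apply_sub_le (hS : IsAccretiveSemigroup G S)
    {u f : H} (hu : (u, f) ∈ G) {t : ℝ} (ht : 0 ≤ t) :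
    ‖S t u - u‖ ≤ t * ‖f‖ := by
  have h := norm_image_sub_le_of_norm_deriv_right_le_segment (hS.continuousOn_Icc u t)
    (fun s hs => hS.hasDerivWithinAt hu hs.1) (C := ‖f‖)
    (fun s hs => by rw [norm_neg]; exact hS.norm_apply_le hs.1 f) t (right_mem_Icc.2 ht)
  simpa [hS.zero, mul_comm] using h

end IsAccretiveSemigroup

end Orbits

/-! ### Operators associated with forms, and parabolic smoothing. -/

section Forms

variable {H V : Type*} [NormedAddCommGroup H] [InnerProductSpace ℝ H]
  [NormedAddCommGroup V] [InnerProductSpace ℝ V]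

/-- The inner product of a real Hilbert space as a continuous bilinear map. -/
noncomputable def realInnerL (H : Type*) [NormedAddCommGroup H] [InnerProductSpace ℝ H] :
    H →L[ℝ] H →L[ℝ] ℝ :=
  (isBoundedBilinearMap_inner (𝕜 := ℝ) (E := H)).toContinuousLinearMap

@[simp]
theorem realInnerL_apply (x y : H) : realInnerL H x y = inner ℝ x y := rfl

/-- The graph of the operator in `H` associated with the form `(w, z) ↦ s(w, z) + (B w, J z)` on
`V`, where `J : V → H`. -/
def formGraph (J : V →L[ℝ] H) (s : V →L[ℝ] V →L[ℝ] ℝ) (B : V →L[ℝ] H) :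
    Submodule ℝ (H × H) where
  carrier := {p | ∃ w, J w = p.1 ∧ ∀ z, s w z + inner ℝ (B w) (J z) = inner ℝ p.2 (J z)}
  zero_mem' := ⟨0, by simp, by simp⟩
  add_mem' := by
    rintro p p' ⟨w, hw, h⟩ ⟨w', hw', h'⟩
    refine ⟨w + w', by simp [hw, hw'], fun z => ?_⟩
    rw [map_add, map_add, _root_.add_apply, Prod.snd_add, inner_add_left, inner_add_left, ← h, ← h']
    ring
  smul_mem' := by
    rintro c p ⟨w, hw, h⟩
    refine ⟨c • w, by simp [hw], fun z => ?_⟩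
    rw [map_smul, map_smul, _root_.smul_apply, Prod.smul_snd, real_inner_smul_left,
      real_inner_smul_left, ← h, smul_eq_mul]
    ring

/-- A symmetric coercive form `s` on `V` perturbed by a skew first order term `B`. -/
structure IsSkewPerturbedForm (J : V →L[ℝ] H) (s : V →L[ℝ] V →L[ℝ] ℝ) (B : V →L[ℝ] H)
    (α : ℝ) : Prop where
  pos : 0 < α
  coercive : ∀ w, α * ‖w‖ ^ 2 ≤ s w w
  symm : ∀ w z, s w z = s z w
  skew : ∀ w, inner ℝ (B w) (J w) = 0
  dense : DenseRange J

namespace IsSkewPerturbedForm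

variable {J : V →L[ℝ] H} {s : V →L[ℝ] V →L[ℝ] ℝ} {B : V →L[ℝ] H} {α : ℝ}

theorem eq_zero_of_forall_inner (hf : IsSkewPerturbedForm J s B α)
    {g : H} (h : ∀ z, inner ℝ g (J z) = 0) : g = 0 := by
  have : ∀ x, inner ℝ g x = 0 := fun x =>
    hf.dense.induction_on (p := fun x => inner ℝ g x = (0 : ℝ)) x
      (isClosed_eq (by fun_prop) continuous_const) h
  simpa using this g

/-- The drift vanishes on the diagonal, so the graph controls the V norm. -/
theorem le_inner (hf : IsSkewPerturbedForm J s B α)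
    {w : V} {p : H × H} (hw : J w = p.1)
    (h : ∀ z, s w z + inner ℝ (B w) (J z) = inner ℝ p.2 (J z)) :
    α * ‖w‖ ^ 2 ≤ inner ℝ p.2 p.1 := by
  rw [← hw, ← h, hf.skew, add_zero]
  exact hf.coercive w

/-- Lax–Milgram solves the resolvent equation. For density, let g be orthogonal to the domain and u
+ f = g with f = Au: then 0 = ‖u‖² + (f, u) with both terms nonnegative, whence w = 0, so that u =
0, and f = 0 by density of the range of J. -/
theorem isMAccretive (hf : IsSkewPerturbedForm J s B α)
    [CompleteSpace V] [CompleteSpace H] : IsMAccretive (formGraph J s B) := by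
  have hacc : ∀ p ∈ formGraph J s B, 0 ≤ inner ℝ p.2 p.1 := by
    rintro p ⟨w, hw, h⟩
    have := hf.pos
    exact le_trans (by positivity) (hf.le_inner hw h)
  have hres : ∀ l : ℝ, 0 < l → ∀ g : H, ∃ p ∈ formGraph J s B, l • p.1 + p.2 = g := by
    intro l hl g
    let a : V →L[ℝ] V →L[ℝ] ℝ := s + (realInnerL H).bilinearComp (B + l • J) J
    have ha : ∀ w z, a w z = s w z + inner ℝ (B w) (J z) + l * inner ℝ (J w) (J z) := by
      intro w z
      simp [a, add_assoc]
    have hco : IsCoercive a := by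
      refine ⟨α, hf.pos, fun w => ?_⟩
      rw [ha, hf.skew, real_inner_self_eq_norm_sq]
      have := hf.coercive w
      have : 0 ≤ l * ‖J w‖ ^ 2 := by positivity
      nlinarith
    let w := hco.continuousLinearEquivOfBilin.symm (J.adjoint g)
    have hw : ∀ z, a w z = inner ℝ g (J z) := fun z => by
      rw [← hco.continuousLinearEquivOfBilin_apply, ContinuousLinearEquiv.apply_symm_apply,
        ContinuousLinearMap.adjoint_inner_left]
    refine ⟨(J w, g - l • J w), ⟨w, rfl, fun z => ?_⟩, by simp⟩
    rw [inner_sub_left, ← hw, ha, real_inner_smul_left]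
    ring
  refine ⟨hacc, hres, ?_⟩
  let K : Submodule ℝ H := (formGraph J s B).map (LinearMap.fst ℝ H H)
  have hK : (K : Set H) = {u : H | ∃ f, (u, f) ∈ formGraph J s B} := by
    ext u
    simp [K]
  rw [← hK, Submodule.dense_iff_topologicalClosure_eq_top,
    Submodule.topologicalClosure_eq_top_iff, Submodule.eq_bot_iff]
  intro g hg
  obtain ⟨⟨u, f⟩, ⟨w, hw, h⟩, he⟩ := hres 1 one_pos g
  have h0 : inner ℝ u g = 0 := (Submodule.mem_orthogonal K g).1 hg u
    (by rw [← SetLike.mem_coe, hK]; exact ⟨f, w, hw, h⟩)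
  have h1 := hf.le_inner hw h
  simp only at he hw h h1
  rw [← he, one_smul, inner_add_right, real_inner_self_eq_norm_sq, real_inner_comm] at h0
  have hw0 : w = 0 := by
    have := hf.pos
    have h2 : α * ‖w‖ ^ 2 ≤ 0 := by nlinarith [sq_nonneg ‖u‖]
    have h3 : ‖w‖ ^ 2 ≤ 0 := by
      by_contra! hc
      nlinarith
    simpa using le_antisymm h3 (sq_nonneg _)
  subst hw0
  have hf0 : f = 0 := hf.eq_zero_of_forall_inner fun z => by simpa using (h z).symm
  rw [← he, ← hw, hf0]
  simp

/-- Parabolic smoothing: `‖A S(t) x‖ ≤ C ‖x‖ / t` for `0 < t ≤ T`. -/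
theorem norm_generator_apply_le (hf : IsSkewPerturbedForm J s B α)
    {S : ℝ → H →L[ℝ] H}
    (hS : IsAccretiveSemigroup (formGraph J s B) S) {T : ℝ} {t : ℝ} (ht : 0 ≤ t) (htT : t ≤ T)
    {x f : H} (hx : (x, f) ∈ formGraph J s B) :
    (t * ‖S t f‖) ^ 2 ≤ (‖s‖ + T * ‖B‖ ^ 2) / α * ‖x‖ ^ 2 := by
  have hα := hf.pos
  have hT : 0 ≤ T := ht.trans htT
  choose! w hw hwf using fun (τ : ℝ) (hτ : 0 ≤ τ) => hS.mem_graph hx hτ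
  simp only at hw hwf
  -- Coercivity turns continuity of the orbits of x and f in H into continuity of the representative
  -- w in V.
  have hdiff : ∀ {τ σ : ℝ}, 0 ≤ τ → 0 ≤ σ →
      α * ‖w τ - w σ‖ ^ 2 ≤ inner ℝ (S τ f - S σ f) (S τ x - S σ x) := fun {τ σ} hτ hσ => by
    refine hf.le_inner (p := (S τ x - S σ x, S τ f - S σ f)) (w := w τ - w σ)
      (by rw [map_sub, hw τ hτ, hw σ hσ]) fun z => ?_
    have h1 := hwf τ hτ z
    have h2 := hwf σ hσ z
    simp only [map_sub, _root_.sub_apply, inner_sub_left]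
    linarith
  have hwc : ContinuousOn w (Ici 0) := by
    intro τ hτ
    rw [ContinuousWithinAt, tendsto_iff_norm_sub_tendsto_zero]
    have h1 : Tendsto (fun σ => α⁻¹ * inner ℝ (S σ f - S τ f) (S σ x - S τ x)) (𝓝[Ici 0] τ)
        (𝓝 0) := by
      simpa using ((((hS.continuousOn f τ hτ).sub_const _).inner
        ((hS.continuousOn x τ hτ).sub_const (S τ x))).const_mul α⁻¹)
    have h2 : Tendsto (fun σ => ‖w σ - w τ‖ ^ 2) (𝓝[Ici 0] τ) (𝓝 0) := by
      refine squeeze_zero' (Eventually.of_forall fun σ => by positivity) ?_ h1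
      filter_upwards [self_mem_nhdsWithin] with σ hσ
      rw [le_inv_mul_iff₀ hα]
      exact hdiff hσ hτ
    simpa using h2.sqrt
  -- No derivative of w in V is needed: by symmetry the increment is s(wσ + wτ, wσ - wτ), and the
  -- equation rewrites it as an inner product in H with S(σ)x - S(τ)x.
  have hE : ∀ τ, 0 ≤ τ → HasDerivWithinAt (fun σ => s (w σ) (w σ))
      (-(2 * inner ℝ (S τ f - B (w τ)) (S τ f))) (Ici τ) τ := by
    intro τ hτ
    have hd := hS.hasDerivWithinAt hx hτ
    rw [← hasDerivWithinAt_Ioi_iff_Ici, hasDerivWithinAt_iff_tendsto_slope' self_notMem_Ioi]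
      at hd ⊢
    have hsub : Ioi τ ⊆ Ici (0 : ℝ) := fun σ hσ => hτ.trans (le_of_lt hσ)
    have hwτ : Tendsto w (𝓝[>] τ) (𝓝 (w τ)) := (hwc τ hτ).mono_left (nhdsWithin_mono _ hsub)
    have hfτ : Tendsto (fun σ => S σ f) (𝓝[>] τ) (𝓝 (S τ f)) :=
      (hS.continuousOn f τ hτ).mono_left (nhdsWithin_mono _ hsub)
    have hg := ((hfτ.sub ((B.continuous.tendsto _).comp hwτ)).add_const
      (S τ f - B (w τ))).inner (𝕜 := ℝ) hd
    have e : inner ℝ (S τ f - B (w τ) + (S τ f - B (w τ))) (-(S τ f))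
        = -(2 * inner ℝ (S τ f - B (w τ)) (S τ f)) := by
      rw [inner_neg_right, inner_add_left]; ring
    rw [e] at hg
    refine hg.congr' ?_
    filter_upwards [self_mem_nhdsWithin] with σ hσ
    have hσ0 : 0 ≤ σ := hsub hσ
    have h1 := hwf τ hτ (w σ - w τ)
    have h2 := hwf σ hσ0 (w σ - w τ)
    have h3 := hf.symm (w σ) (w τ)
    have e1 : s (w σ) (w σ) - s (w τ) (w τ) = s (w σ) (w σ - w τ) + s (w τ) (w σ - w τ) := by
      rw [map_sub, map_sub, h3]; ring
    rw [slope_def_module, slope_def_module, e1, real_inner_smul_right, smul_eq_mul,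
      inner_add_left, Function.comp_apply, inner_sub_left, inner_sub_left, ← hw σ hσ0, ← hw τ hτ,
      ← map_sub, ← h1, ← h2]
    ring
  -- With this c, the dissipation c(AS(τ)x, S(τ)x) ≥ cα‖w‖² absorbs s(w,w) and the drift term
  -- τ‖Bw‖². The surplus -τ‖S(τ)f‖² pays for the derivative of the last term below, since ‖S(τ)f‖ ≥
  -- ‖S(t)f‖. Comparing τ = t with τ = 0 gives the bound.
  set c : ℝ := (‖s‖ + T * ‖B‖ ^ 2) / α with hc
  have hcα : c * α = ‖s‖ + T * ‖B‖ ^ 2 := by rw [hc]; field_simp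
  have key := le_initial_of_deriv_right_nonpos (t := t)
    (f := fun τ => τ * s (w τ) (w τ) + c / 2 * ‖S τ x‖ ^ 2 + ‖S t f‖ ^ 2 / 2 * τ ^ 2)
    (f' := fun τ => (1 * s (w τ) (w τ) + τ * (-(2 * inner ℝ (S τ f - B (w τ)) (S τ f))))
      + c / 2 * (2 * inner ℝ (S τ x) (-(S τ f))) + ‖S t f‖ ^ 2 / 2 * (2 * τ)) ht ?_ ?_ ?_
  · have h0 := hf.coercive (w t)
    have h1 : 0 ≤ t * s (w t) (w t) := mul_nonneg ht (le_trans (by positivity) h0)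
    have h2 : 0 ≤ c / 2 * ‖S t x‖ ^ 2 := by positivity
    simp only [zero_mul, hS.zero, ContinuousLinearMap.id_apply] at key
    nlinarith
  · have hw' := hwc.mono (Icc_subset_Ici_self : Icc 0 t ⊆ Ici 0)
    exact ((continuousOn_id.mul ((s.continuous.comp_continuousOn hw').clm_apply hw')).add
      (continuousOn_const.mul ((hS.continuousOn_Icc x t).norm.pow 2))).add
      (continuousOn_const.mul (continuousOn_id.pow 2))
  · intro τ hτ
    have h1 := (hasDerivWithinAt_id τ (Ici τ)).mul (hE τ hτ.1)
    have h2 := ((hS.hasDerivWithinAt hx hτ.1).norm_sq).const_mul (c / 2)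
    have h3 := ((hasDerivAt_pow 2 τ).hasDerivWithinAt (s := Ici τ)).const_mul (‖S t f‖ ^ 2 / 2)
    convert! (h1.add h2).add h3 using 1
    simp
  · intro τ hτ
    have hmono : ‖S t f‖ ^ 2 ≤ ‖S τ f‖ ^ 2 := by
      have h := hS.add_apply (sub_nonneg.2 hτ.2.le) hτ.1 f
      rw [sub_add_cancel] at h
      rw [h]
      gcongr
      exact hS.norm_apply_le (sub_nonneg.2 hτ.2.le) _
    have hs1 : s (w τ) (w τ) ≤ ‖s‖ * ‖w τ‖ ^ 2 := by
      refine (le_abs_self _).trans ((s.le_opNorm₂ _ _).trans (le_of_eq (by ring)))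
    have hB1 : ‖B (w τ)‖ ^ 2 ≤ ‖B‖ ^ 2 * ‖w τ‖ ^ 2 := by
      rw [← mul_pow]
      gcongr
      exact B.le_opNorm _
    have hB2 : 2 * inner ℝ (B (w τ)) (S τ f) ≤ ‖B (w τ)‖ ^ 2 + ‖S τ f‖ ^ 2 := by
      nlinarith [real_inner_le_norm (B (w τ)) (S τ f), sq_nonneg (‖B (w τ)‖ - ‖S τ f‖)]
    have hα1 := hf.le_inner (p := (S τ x, S τ f)) (hw τ hτ.1) (hwf τ hτ.1)
    simp only at hα1
    have hc0 : 0 ≤ c := by positivity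
    have h4 : c * (α * ‖w τ‖ ^ 2) ≤ c * inner ℝ (S τ f) (S τ x) := by gcongr
    have h5 : τ * (2 * inner ℝ (B (w τ)) (S τ f)) ≤ τ * (‖B (w τ)‖ ^ 2 + ‖S τ f‖ ^ 2) :=
      mul_le_mul_of_nonneg_left hB2 hτ.1
    have h6 : τ * ‖B (w τ)‖ ^ 2 ≤ T * (‖B‖ ^ 2 * ‖w τ‖ ^ 2) := by
      gcongr
      exact hτ.2.le.trans htT
    have h7 : τ * ‖S t f‖ ^ 2 ≤ τ * ‖S τ f‖ ^ 2 := mul_le_mul_of_nonneg_left hmono hτ.1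
    have h8 : c * (α * ‖w τ‖ ^ 2) = ‖s‖ * ‖w τ‖ ^ 2 + T * (‖B‖ ^ 2 * ‖w τ‖ ^ 2) := by
      rw [← mul_assoc, hcα]; ring
    rw [inner_sub_left, real_inner_self_eq_norm_sq, inner_neg_right,
      real_inner_comm (S τ f) (S τ x)]
    linarith

/-- For u in the domain, the orbit of S(t)u has speed at most ‖AS(t)u‖, which smoothing bounds by
C‖u‖/t; density does the rest. -/
theorem norm_semigroup_sub_le (hf : IsSkewPerturbedForm J s B α)
    {S : ℝ → H →L[ℝ] H}
    (hS : IsAccretiveSemigroup (formGraph J s B) S) (T : ℝ) :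
    ∃ C, 0 ≤ C ∧ ∀ t, 0 < t → t ≤ T → ∀ h, 0 ≤ h → ∀ x,
      ‖S (t + h) x - S t x‖ ≤ C * (h / t) * ‖x‖ := by
  refine ⟨√((‖s‖ + T * ‖B‖ ^ 2) / α), Real.sqrt_nonneg _, fun t ht htT h hh x => ?_⟩
  have hα := hf.pos
  have hT : 0 ≤ T := ht.le.trans htT
  refine hS.dense.induction (P := fun x => ‖S (t + h) x - S t x‖
    ≤ √((‖s‖ + T * ‖B‖ ^ 2) / α) * (h / t) * ‖x‖) ?_ (isClosed_le (by fun_prop) (by fun_prop)) x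
  rintro u ⟨f, hu⟩
  have h1 := hf.norm_generator_apply_le hS ht.le htT hu
  have h2 := hS.norm_apply_sub_le (hS.mem_graph hu ht.le) hh
  rw [add_comm, hS.add_apply hh ht.le]
  refine h2.trans ?_
  have h3 : t * ‖S t f‖ ≤ √((‖s‖ + T * ‖B‖ ^ 2) / α) * ‖u‖ := by
    refine (sq_le_sq₀ (by positivity) (by positivity)).1 ?_
    rwa [mul_pow (√_), Real.sq_sqrt (by positivity)]
  calc h * ‖S t f‖ = h / t * (t * ‖S t f‖) := by field_simp
    _ ≤ h / t * (√((‖s‖ + T * ‖B‖ ^ 2) / α) * ‖u‖) := by gcongr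
    _ = _ := by ring

end IsSkewPerturbedForm

end Forms

/-! ### Time regularity of mild solutions. -/

section Mild

variable {H : Type*} [NormedAddCommGroup H] [InnerProductSpace ℝ H]
  {G : Submodule ℝ (H × H)} {S : ℝ → H →L[ℝ] H}

theorem IsAccretiveSemigroup.norm_apply_sub_apply_le (hS : IsAccretiveSemigroup G S) {u f : H}
    (hu : (u, f) ∈ G) {t₁ t₂ : ℝ} (ht₁ : 0 ≤ t₁) (h : t₁ ≤ t₂) :
    ‖S t₂ u - S t₁ u‖ ≤ (t₂ - t₁) * ‖f‖ := by
  have h1 := hS.add_apply ht₁ (sub_nonneg.2 h) u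
  rw [add_sub_cancel] at h1
  rw [h1, ← map_sub]
  exact (hS.norm_apply_le ht₁ _).trans (hS.norm_apply_sub_le hu (sub_nonneg.2 h))

/-- Interpolation between the contraction and the smoothing estimate. -/
theorem norm_semigroup_sub_le_rpow {S : ℝ → H →L[ℝ] H}
    (hcontr : ∀ t, 0 ≤ t → ∀ x, ‖S t x‖ ≤ ‖x‖) {T C : ℝ} (hC : 0 ≤ C)
    (hsm : ∀ t, 0 < t → t ≤ T → ∀ h, 0 ≤ h → ∀ x, ‖S (t + h) x - S t x‖ ≤ C * (h / t) * ‖x‖)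
    {θ : ℝ} (hθ0 : 0 ≤ θ) (hθ1 : θ ≤ 1) {t h : ℝ} (ht : 0 < t) (htT : t ≤ T) (hh : 0 < h) (x : H) :
    ‖S (t + h) x - S t x‖ ≤ (2 + C) * (h / t) ^ θ * ‖x‖ := by
  rcases le_total 1 (h / t) with h1 | h1
  · have h2 : 1 ≤ (h / t) ^ θ := Real.one_le_rpow h1 hθ0
    have h3 := norm_sub_le (S (t + h) x) (S t x)
    have h4 := hcontr (t + h) (by positivity) x
    have h5 := hcontr t ht.le x
    have h6 : 2 * ‖x‖ ≤ (2 + C) * (h / t) ^ θ * ‖x‖ := by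
      gcongr
      nlinarith
    linarith
  · refine (hsm t ht htT h hh.le x).trans ?_
    have h2 : h / t ≤ (h / t) ^ θ := by
      simpa using Real.rpow_le_rpow_of_exponent_ge (div_pos hh ht) h1 hθ1
    gcongr
    linarith

theorem integral_sub_left_rpow {t ε : ℝ} (hε : 0 < ε) :
    ∫ s in (0 : ℝ)..t, (t - s) ^ (ε - 1) = t ^ ε / ε := by
  rw [intervalIntegral.integral_comp_sub_left (fun u => u ^ (ε - 1)), sub_self, sub_zero,
    integral_rpow (Or.inl (by linarith)), sub_add_cancel, Real.zero_rpow hε.ne', sub_zero]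

theorem intervalIntegrable_sub_left_rpow {t ε : ℝ} (hε : 0 < ε) :
    IntervalIntegrable (fun s : ℝ => (t - s) ^ (ε - 1)) volume 0 t := by
  have h : IntervalIntegrable (fun u : ℝ => u ^ (ε - 1)) volume 0 t :=
    intervalIntegral.intervalIntegrable_rpow' (by linarith)
  simpa using (h.comp_sub_left t).symm

/-- Interpolation with θ = 1 - ε leaves the kernel (t₁-s)^(ε-1), whose integral t₁^ε/ε produces the
term (2 + C)/ε. -/
theorem norm_mild_sub_le_rpow (hS : IsAccretiveSemigroup G S) {T C : ℝ} (hC : 0 ≤ C)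
    (hsm : ∀ t, 0 < t → t ≤ T → ∀ h, 0 ≤ h → ∀ x, ‖S (t + h) x - S t x‖ ≤ C * (h / t) * ‖x‖)
    {ε : ℝ} (hε : 0 < ε) (hε1 : ε ≤ 1) {R : ℝ → H → H} {X₀ AX₀ : H} {X : ℝ → H}
    (hX₀ : (X₀, AX₀) ∈ G) (hX : IsMildSolution S R T X₀ X) {M : ℝ}
    (hM : ∀ s ∈ Icc 0 T, ‖R s (X s)‖ ≤ M) {t₁ t₂ : ℝ} (ht₁ : t₁ ∈ Icc 0 T) (ht₂ : t₂ ∈ Icc 0 T)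
    (h12 : t₁ < t₂) :
    ‖X t₂ - X t₁‖ ≤ T ^ ε * (1 + (2 + C) / ε) * (t₂ - t₁) ^ (1 - ε) * (‖AX₀‖ + M) := by
  have hδ : 0 < t₂ - t₁ := sub_pos.2 h12
  have hM0 : 0 ≤ M := (norm_nonneg _).trans (hM t₁ ht₁)
  have hint₂ := hX.integrable t₂ ht₂
  have hint₁ := hX.integrable t₁ ht₁
  have hsub₁ : uIcc 0 t₁ ⊆ uIcc 0 t₂ := by
    rw [uIcc_of_le ht₁.1, uIcc_of_le ht₂.1]; exact Icc_subset_Icc_right h12.le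
  have hsub₂ : uIcc t₁ t₂ ⊆ uIcc 0 t₂ := by
    rw [uIcc_of_le h12.le, uIcc_of_le ht₂.1]; exact Icc_subset_Icc_left ht₁.1
  have hi₁ := hint₂.mono_set hsub₁
  have hi₂ := hint₂.mono_set hsub₂
  have hdec : X t₂ - X t₁ = (S t₂ X₀ - S t₁ X₀)
      + (∫ s in (0 : ℝ)..t₁, (S (t₂ - s) (R s (X s)) - S (t₁ - s) (R s (X s))))
      + ∫ s in t₁..t₂, S (t₂ - s) (R s (X s)) := by
    rw [hX.eq t₂ ht₂, hX.eq t₁ ht₁, intervalIntegral.integral_sub hi₁ hint₁,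
      ← intervalIntegral.integral_add_adjacent_intervals hi₁ hi₂]
    abel
  have hb₁ := hS.norm_apply_sub_apply_le hX₀ ht₁.1 h12.le
  have hb₃ : ‖∫ s in t₁..t₂, S (t₂ - s) (R s (X s))‖ ≤ M * (t₂ - t₁) := by
    have h := intervalIntegral.norm_integral_le_of_norm_le_const (a := t₁) (b := t₂)
      (f := fun s => S (t₂ - s) (R s (X s))) (C := M) fun s hs => by
        rw [uIoc_of_le h12.le] at hs
        exact (hS.norm_apply_le (sub_nonneg.2 hs.2) _).trans
          (hM s ⟨ht₁.1.trans hs.1.le, hs.2.trans ht₂.2⟩)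
    rwa [abs_of_pos hδ] at h
  have hb₂ : ‖∫ s in (0 : ℝ)..t₁, (S (t₂ - s) (R s (X s)) - S (t₁ - s) (R s (X s)))‖
      ≤ (2 + C) * (t₂ - t₁) ^ (1 - ε) * M * (t₁ ^ ε / ε) := by
    have h := intervalIntegral.norm_integral_le_of_norm_le (μ := volume) ht₁.1
      (f := fun s => S (t₂ - s) (R s (X s)) - S (t₁ - s) (R s (X s)))
      (g := fun s => (2 + C) * (t₂ - t₁) ^ (1 - ε) * M * (t₁ - s) ^ (ε - 1)) ?_
      ((intervalIntegrable_sub_left_rpow hε).const_mul _)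
    · rwa [intervalIntegral.integral_const_mul, integral_sub_left_rpow hε] at h
    · have hne : ∀ᵐ s : ℝ, s ≠ t₁ := compl_mem_ae_iff.2 (measure_singleton t₁)
      filter_upwards [hne] with s hs hs'
      have hlt : 0 < t₁ - s := sub_pos.2 (lt_of_le_of_ne hs'.2 hs)
      have h := norm_semigroup_sub_le_rpow (fun t ht x => hS.norm_apply_le ht x) hC hsm
        (θ := 1 - ε) (by linarith) (by linarith) hlt (by linarith [hs'.1, ht₁.2]) hδ (R s (X s))
      rw [show t₁ - s + (t₂ - t₁) = t₂ - s by ring, Real.div_rpow hδ.le hlt.le] at h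
      refine h.trans ?_
      have e : (t₁ - s) ^ (ε - 1) = ((t₁ - s) ^ (1 - ε))⁻¹ := by
        rw [← Real.rpow_neg hlt.le, neg_sub]
      rw [e, div_eq_mul_inv]
      have := hM s ⟨hs'.1.le, hs'.2.trans ht₁.2⟩
      calc (2 + C) * ((t₂ - t₁) ^ (1 - ε) * ((t₁ - s) ^ (1 - ε))⁻¹) * ‖R s (X s)‖
          ≤ (2 + C) * ((t₂ - t₁) ^ (1 - ε) * ((t₁ - s) ^ (1 - ε))⁻¹) * M := by gcongr
        _ = _ := by ring
  -- The two Lipschitz terms are weakened to the common exponent 1 - ε.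
  have hδe : t₂ - t₁ ≤ (t₂ - t₁) ^ (1 - ε) * T ^ ε := by
    calc t₂ - t₁ = (t₂ - t₁) ^ (1 - ε) * (t₂ - t₁) ^ ε := by
          rw [← Real.rpow_add hδ, sub_add_cancel, Real.rpow_one]
      _ ≤ (t₂ - t₁) ^ (1 - ε) * T ^ ε := by
          gcongr
          linarith [ht₁.1, ht₂.2]
  have ht₁e : t₁ ^ ε ≤ T ^ ε := Real.rpow_le_rpow ht₁.1 ht₁.2 hε.le
  have hT0 : 0 ≤ T := ht₁.1.trans ht₁.2
  set P := (t₂ - t₁) ^ (1 - ε) with hP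
  have hP0 : 0 ≤ P := by positivity
  rw [hdec]
  refine (norm_add_le _ _).trans ((add_le_add_left (norm_add_le _ _) _).trans ?_)
  calc _ ≤ (t₂ - t₁) * ‖AX₀‖ + (2 + C) * P * M * (t₁ ^ ε / ε) + M * (t₂ - t₁) :=
        add_le_add (add_le_add hb₁ hb₂) hb₃
    _ ≤ (P * T ^ ε) * ‖AX₀‖ + (2 + C) * P * M * (T ^ ε / ε) + M * (P * T ^ ε) := by gcongr
    _ = T ^ ε * P * (‖AX₀‖ + M + (2 + C) / ε * M) := by ring
    _ ≤ T ^ ε * P * (‖AX₀‖ + M + (2 + C) / ε * (‖AX₀‖ + M)) := by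
        gcongr
        linarith [norm_nonneg AX₀]
    _ = _ := by ring

/-- The integral form of the Grönwall inequality. -/
theorem le_mul_exp_of_le_add_integral {φ : ℝ → ℝ} {a L t : ℝ} (ht : 0 ≤ t) (hL : 0 ≤ L)
    (hφ : ContinuousOn φ (Icc 0 t))
    (h : ∀ s ∈ Icc 0 t, φ s ≤ a + L * ∫ r in (0 : ℝ)..s, φ r) : φ t ≤ a * Real.exp (L * t) := by
  have hcont : ContinuousOn (fun s => a + L * ∫ r in (0 : ℝ)..s, φ r) (Icc 0 t) := by
    refine continuousOn_const.add (continuousOn_const.mul ?_)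
    have := intervalIntegral.continuousOn_primitive_interval (μ := volume) (f := φ) (a := 0)
      (b := t) (by rw [uIcc_of_le ht]; exact hφ.integrableOn_Icc)
    rwa [uIcc_of_le ht] at this
  have hder : ∀ s ∈ Ico 0 t, HasDerivWithinAt (fun s => a + L * ∫ r in (0 : ℝ)..s, φ r)
      (L * φ s) (Ici s) s := by
    intro s hs
    have hint : IntervalIntegrable φ volume 0 s :=
      (hφ.mono (Icc_subset_Icc_right hs.2.le)).intervalIntegrable_of_Icc hs.1
    have hmem : Icc 0 t ∈ 𝓝[>] s :=
      mem_of_superset (Ioo_mem_nhdsGT hs.2) fun r hr => ⟨hs.1.trans hr.1.le, hr.2.le⟩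
    have hc : ContinuousWithinAt φ (Ioi s) s :=
      (hφ s ⟨hs.1, hs.2.le⟩).mono_of_mem_nhdsWithin hmem
    have hm : StronglyMeasurableAtFilter φ (𝓝[>] s) volume :=
      ⟨Icc 0 t, hmem, hφ.aestronglyMeasurable measurableSet_Icc⟩
    have := intervalIntegral.integral_hasDerivWithinAt_right (s := Ici s) (t := Ioi s) hint hm hc
    exact (this.const_mul L).const_add a
  -- The differential inequality holds for the majorant a + L∫φ, whose derivative Lφ is at most L
  -- times itself.
  have hg := le_gronwallBound_of_liminf_deriv_right_le (δ := a) (K := L) (ε := 0) hcont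
    (f' := fun s => L * φ s)
    (fun s hs r hr => (hder s hs).liminf_right_slope_le hr) (by simp)
    (fun s hs => by
      rw [add_zero]
      exact mul_le_mul_of_nonneg_left (h s ⟨hs.1, hs.2.le⟩) hL) t (right_mem_Icc.2 ht)
  rw [gronwallBound_ε0, sub_zero] at hg
  exact (h t (right_mem_Icc.2 ht)).trans hg

/-- Compare X with its translate X(· + h). Shifting the variable leaves an integral over [0,h], at
most Mh, and one with S applied to an increment of R, at most L∫‖X(s+h) - X(s)‖ds + TKh; Grönwall
then applies. -/
theorem norm_mild_sub_le (hS : IsAccretiveSemigroup G S) {T L K : ℝ} (hL : 0 ≤ L) (hK : 0 ≤ K)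
    {R : ℝ → H → H} (hR : ∀ s ∈ Icc 0 T, ∀ t ∈ Icc 0 T, ∀ Y Z : H,
      ‖R s Y - R t Z‖ ≤ L * ‖Y - Z‖ + K * |s - t|)
    {X₀ AX₀ : H} {X : ℝ → H}
    (hX₀ : (X₀, AX₀) ∈ G) (hX : IsMildSolution S R T X₀ X) {M : ℝ}
    (hM : ∀ s ∈ Icc 0 T, ‖R s (X s)‖ ≤ M) {t₁ t₂ : ℝ} (ht₁ : t₁ ∈ Icc 0 T) (ht₂ : t₂ ∈ Icc 0 T)
    (h12 : t₁ < t₂) :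
    ‖X t₂ - X t₁‖ ≤ (1 + T) * Real.exp (L * T) * (t₂ - t₁) * (‖AX₀‖ + M + K) := by
  obtain ⟨h, hh, rfl⟩ : ∃ h, 0 < h ∧ t₂ = t₁ + h := ⟨t₂ - t₁, sub_pos.2 h12, by ring⟩
  have hM0 : 0 ≤ M := (norm_nonneg _).trans (hM t₁ ht₁)
  have hT0 : 0 ≤ T := ht₁.1.trans ht₁.2
  have hmem : ∀ {s}, s ∈ Icc 0 t₁ → s ∈ Icc 0 T ∧ s + h ∈ Icc 0 T := fun {s} hs =>
    ⟨⟨hs.1, hs.2.trans ht₁.2⟩, by linarith [hs.1], by linarith [hs.2, ht₂.2]⟩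
  have hφ : ContinuousOn (fun s => ‖X (s + h) - X s‖) (Icc 0 t₁) := by
    refine ((hX.continuousOn.comp (by fun_prop) fun s hs => (hmem hs).2).sub
      (hX.continuousOn.mono fun s hs => (hmem hs).1)).norm
  have hineq : ∀ t ∈ Icc 0 t₁, ‖X (t + h) - X t‖
      ≤ (h * ‖AX₀‖ + M * h + T * (K * h)) + L * ∫ s in (0 : ℝ)..t, ‖X (s + h) - X s‖ := by
    intro t ht
    have hint₁ := hX.integrable t (hmem ht).1
    have hint₂ := hX.integrable (t + h) (hmem ht).2
    have hth : 0 ≤ t + h := by linarith [ht.1]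
    have hi₁ : IntervalIntegrable (fun s => S (t + h - s) (R s (X s))) volume 0 h := by
      refine hint₂.mono_set ?_
      rw [uIcc_of_le hh.le, uIcc_of_le hth]
      exact Icc_subset_Icc_right (by linarith [ht.1])
    have hi₂ : IntervalIntegrable (fun s => S (t + h - s) (R s (X s))) volume h (t + h) := by
      refine hint₂.mono_set ?_
      rw [uIcc_of_le (by linarith [ht.1]), uIcc_of_le hth]
      exact Icc_subset_Icc_left hh.le
    have hi₃ : IntervalIntegrable (fun s => S (t - s) (R (s + h) (X (s + h)))) volume 0 t := by
      simpa using hi₂.comp_add_right h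
    have hshift : ∫ s in h..t + h, S (t + h - s) (R s (X s))
        = ∫ s in (0 : ℝ)..t, S (t - s) (R (s + h) (X (s + h))) := by
      have := intervalIntegral.integral_comp_add_right (a := 0) (b := t)
        (fun s => S (t + h - s) (R s (X s))) h
      rw [zero_add] at this
      rw [← this]
      simp
    have hdec : X (t + h) - X t = (S (t + h) X₀ - S t X₀)
        + (∫ s in (0 : ℝ)..h, S (t + h - s) (R s (X s)))
        + ∫ s in (0 : ℝ)..t, (S (t - s) (R (s + h) (X (s + h))) - S (t - s) (R s (X s))) := by
      rw [hX.eq _ (hmem ht).2, hX.eq _ (hmem ht).1, intervalIntegral.integral_sub hi₃ hint₁,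
        ← intervalIntegral.integral_add_adjacent_intervals hi₁ hi₂, hshift]
      abel
    have hb₁ := hS.norm_apply_sub_apply_le hX₀ ht.1 (show t ≤ t + h by linarith)
    rw [add_sub_cancel_left] at hb₁
    have hb₂ : ‖∫ s in (0 : ℝ)..h, S (t + h - s) (R s (X s))‖ ≤ M * h := by
      have h := intervalIntegral.norm_integral_le_of_norm_le_const (a := 0) (b := h)
        (f := fun s => S (t + h - s) (R s (X s))) (C := M) fun s hs => by
          rw [uIoc_of_le hh.le] at hs
          exact (hS.norm_apply_le (by linarith [hs.2, ht.1]) _).trans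
            (hM s ⟨hs.1.le, hs.2.trans (le_trans (by linarith [ht.1]) (hmem ht).2.2)⟩)
      rwa [sub_zero, abs_of_pos hh] at h
    have hφi : IntervalIntegrable (fun s => ‖X (s + h) - X s‖) volume 0 t :=
      (hφ.mono (Icc_subset_Icc_right ht.2)).intervalIntegrable_of_Icc ht.1
    have hb₃ : ‖∫ s in (0 : ℝ)..t, (S (t - s) (R (s + h) (X (s + h))) - S (t - s) (R s (X s)))‖
        ≤ L * (∫ s in (0 : ℝ)..t, ‖X (s + h) - X s‖) + t * (K * h) := by
      have hb := intervalIntegral.norm_integral_le_of_norm_le (μ := volume) ht.1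
        (f := fun s => S (t - s) (R (s + h) (X (s + h))) - S (t - s) (R s (X s)))
        (g := fun s => L * ‖X (s + h) - X s‖ + K * h) ?_
        ((hφi.const_mul L).add intervalIntegrable_const)
      · rwa [intervalIntegral.integral_add (hφi.const_mul L) intervalIntegrable_const,
          intervalIntegral.integral_const_mul, intervalIntegral.integral_const, sub_zero,
          smul_eq_mul] at hb
      · refine Eventually.of_forall fun s hs => ?_
        have hs' : s ∈ Icc 0 t₁ := ⟨hs.1.le, hs.2.trans ht.2⟩
        rw [← map_sub]
        refine (hS.norm_apply_le (sub_nonneg.2 hs.2) _).trans ?_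
        have := hR (s + h) (hmem hs').2 s (hmem hs').1 (X (s + h)) (X s)
        rwa [add_sub_cancel_left, abs_of_pos hh] at this
    rw [hdec]
    refine (norm_add_le _ _).trans ((add_le_add_left (norm_add_le _ _) _).trans ?_)
    have : t * (K * h) ≤ T * (K * h) := by
      gcongr
      exact (hmem ht).1.2
    linarith
  have hg := le_mul_exp_of_le_add_integral ht₁.1 hL hφ hineq
  refine hg.trans ?_
  rw [add_sub_cancel_left]
  have hA := norm_nonneg AX₀
  calc (h * ‖AX₀‖ + M * h + T * (K * h)) * Real.exp (L * t₁)
      ≤ ((1 + T) * h * (‖AX₀‖ + M + K)) * Real.exp (L * T) := by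
        have h1 : 0 ≤ T * h * (‖AX₀‖ + M) := by positivity
        have h2 : 0 ≤ h * K := by positivity
        gcongr
        · nlinarith
        · exact ht₁.2
    _ = _ := by ring

/-- The hypothesis on R makes s ↦ R(s, X(s)) continuous on a compact interval. The `sSup` in (ii) is
thus a true supremum, not the default value 0. -/
theorem IsMildSolution.bddAbove_reaction {T L K : ℝ} {R : ℝ → H → H}
    (hR : ∀ s ∈ Icc 0 T, ∀ t ∈ Icc 0 T, ∀ Y Z : H, ‖R s Y - R t Z‖ ≤ L * ‖Y - Z‖ + K * |s - t|)
    {X₀ : H} {X : ℝ → H} (hX : IsMildSolution S R T X₀ X) :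
    BddAbove ((fun s => ‖R s (X s)‖) '' Icc 0 T) := by
  refine isCompact_Icc.bddAbove_image (ContinuousOn.norm fun t ht => ?_)
  rw [ContinuousWithinAt, tendsto_iff_norm_sub_tendsto_zero]
  refine squeeze_zero' (Eventually.of_forall fun s => norm_nonneg _)
    (g := fun s => L * ‖X s - X t‖ + K * |s - t|) ?_ ?_
  · filter_upwards [self_mem_nhdsWithin] with s hs using hR s hs t ht _ _
  · have h1 : Tendsto (fun s => ‖X s - X t‖) (𝓝[Icc 0 T] t) (𝓝 0) := by
      simpa using ((hX.continuousOn t ht).sub_const (X t)).norm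
    have h2 : Tendsto (fun s : ℝ => |s - t|) (𝓝[Icc 0 T] t) (𝓝 0) := by
      have : Continuous fun s : ℝ => |s - t| := by fun_prop
      simpa using (this.tendsto t).mono_left nhdsWithin_le_nhds
    simpa using (h1.const_mul L).add (h2.const_mul K)

end Mild

/-! ### Bounded coefficients as operators on L². -/

section Multiplication

variable {α : Type*} [MeasurableSpace α] {μ : Measure α} {d : ℕ}

/-- Pointwise application of an essentially bounded field of operators, as an operator on `L²`. -/
theorem exists_multiplication_operator {E F : Type*} [NormedAddCommGroup E] [NormedSpace ℝ E]
    [NormedAddCommGroup F] [NormedSpace ℝ F] {Φ : α → E →L[ℝ] F} (hΦ : MemLp Φ ⊤ μ) :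
    ∃ M : Lp E 2 μ →L[ℝ] Lp F 2 μ, ∀ g : Lp E 2 μ, M g =ᵐ[μ] fun x => Φ x (g x) := by
  refine ⟨(ContinuousLinearMap.id ℝ (E →L[ℝ] F)).holderL μ ⊤ 2 2 hΦ.toLp, fun g => ?_⟩
  filter_upwards [(ContinuousLinearMap.id ℝ (E →L[ℝ] F)).coeFn_holder (r := 2) hΦ.toLp g,
    hΦ.coeFn_toLp] with x h1 h2
  rw [ContinuousLinearMap.holderL_apply_apply, h1, h2]
  rfl

theorem memLp_smul_const {E : Type*} [NormedAddCommGroup E] [NormedSpace ℝ E] {p : ENNReal}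
    {f : α → ℝ} (hf : MemLp f p μ) (e : E) : MemLp (fun x => f x • e) p μ :=
  (ContinuousLinearMap.toSpanSingleton ℝ e).comp_memLp' hf

theorem memLp_sum_smul_const {ι E : Type*} [Fintype ι] [NormedAddCommGroup E] [NormedSpace ℝ E]
    {p : ENNReal} {f : α → ι → ℝ} (hf : ∀ i, MemLp (fun x => f x i) p μ) (e : ι → E) :
    MemLp (fun x => ∑ i, f x i • e i) p μ :=
  memLp_finsetSum Finset.univ (f := fun i x => f x i • e i) fun i _ => memLp_smul_const (hf i) _

theorem exists_matrix_operator {D : α → Matrix (Fin d) (Fin d) ℝ}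
    (hD : ∀ i j, MemLp (fun x => D x i j) ⊤ μ) :
    ∃ M : Lp (Space d) 2 μ →L[ℝ] Lp (Space d) 2 μ, ∀ g h : Lp (Space d) 2 μ,
      (fun x => inner ℝ (M g x) (h x)) =ᵐ[μ] fun x => ∑ i, ∑ j, D x i j * g x j * h x i := by
  -- The matrix field is the sum of its entries times constant rank-one operators, so entrywise
  -- bounds suffice.
  obtain ⟨M, hM⟩ := exists_multiplication_operator (μ := μ)
    (memLp_sum_smul_const (f := fun x (k : Fin d × Fin d) => D x k.1 k.2) (fun k => hD k.1 k.2)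
      fun k => (EuclideanSpace.proj k.2 : Space d →L[ℝ] ℝ).smulRight
        (EuclideanSpace.single k.1 (1 : ℝ)))
  refine ⟨M, fun g h => ?_⟩
  filter_upwards [hM g] with x hx
  rw [hx, ← Fintype.sum_prod_type' fun i j => D x i j * g x j * h x i]
  simp only [_root_.sum_apply, _root_.smul_apply,
    ContinuousLinearMap.smulRight_apply, PiLp.proj_apply, sum_inner,
    real_inner_smul_left, EuclideanSpace.inner_single_left]
  simp [mul_assoc]

theorem matrix_operator_coercive {D : α → Matrix (Fin d) (Fin d) ℝ}
    {M : Lp (Space d) 2 μ →L[ℝ] Lp (Space d) 2 μ} (hM : ∀ g h : Lp (Space d) 2 μ,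
      (fun x => inner ℝ (M g x) (h x)) =ᵐ[μ] fun x => ∑ i, ∑ j, D x i j * g x j * h x i)
    {c : ℝ} (hell : ∀ᵐ x ∂μ, ∀ ξ : Space d, c * ‖ξ‖ ^ 2 ≤ ∑ i, ∑ j, D x i j * ξ i * ξ j)
    (g : Lp (Space d) 2 μ) : c * ‖g‖ ^ 2 ≤ inner ℝ (M g) g := by
  rw [← real_inner_self_eq_norm_sq g, L2.inner_def, L2.inner_def, ← integral_const_mul]
  refine integral_mono_ae ((L2.integrable_inner g g).const_mul c)
    (L2.integrable_inner (M g) g) ?_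
  filter_upwards [hM g g, hell] with x h2 h3
  rw [h2, real_inner_self_eq_norm_sq (g x)]
  refine (h3 _).trans (le_of_eq ?_)
  exact Finset.sum_congr rfl fun i _ => Finset.sum_congr rfl fun j _ => by ring

theorem matrix_operator_symm {D : α → Matrix (Fin d) (Fin d) ℝ}
    {M : Lp (Space d) 2 μ →L[ℝ] Lp (Space d) 2 μ} (hM : ∀ g h : Lp (Space d) 2 μ,
      (fun x => inner ℝ (M g x) (h x)) =ᵐ[μ] fun x => ∑ i, ∑ j, D x i j * g x j * h x i)
    (hD : ∀ᵐ x ∂μ, (D x).IsSymm) (g h : Lp (Space d) 2 μ) :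
    inner ℝ (M g) h = inner ℝ (M h) g := by
  rw [L2.inner_def, L2.inner_def, integral_congr_ae (hM g h), integral_congr_ae (hM h g)]
  refine integral_congr_ae ?_
  filter_upwards [hD] with x hx
  rw [Finset.sum_comm]
  refine Finset.sum_congr rfl fun i _ => Finset.sum_congr rfl fun j _ => ?_
  rw [hx.apply i j]
  ring

theorem exists_vector_operator {q : α → Space d} (hq : ∀ i, MemLp (fun x => q x i) ⊤ μ) :
    ∃ M : Lp (Space d) 2 μ →L[ℝ] Lp ℝ 2 μ, ∀ g : Lp (Space d) 2 μ,
      M g =ᵐ[μ] fun x => ∑ i, q x i * g x i := by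
  obtain ⟨M, hM⟩ := exists_multiplication_operator (μ := μ)
    (memLp_sum_smul_const (f := fun x i => q x i) hq
      fun i => (EuclideanSpace.proj i : Space d →L[ℝ] ℝ))
  refine ⟨M, fun g => ?_⟩
  filter_upwards [hM g] with x hx
  rw [hx]
  simp

end Multiplication

/-- An elliptic form on `V` that is built from a value map `J` and a gradient map `P`. -/
theorem exists_isSkewPerturbedForm_of_gradient {V H K : Type*} [NormedAddCommGroup V]
    [InnerProductSpace ℝ V] [NormedAddCommGroup H] [InnerProductSpace ℝ H] [NormedAddCommGroup K]
    [InnerProductSpace ℝ K] {J : V →L[ℝ] H} {P : V →L[ℝ] K}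
    (hnorm : ∀ w, ‖w‖ ^ 2 = ‖J w‖ ^ 2 + ‖P w‖ ^ 2) (hJ : DenseRange J)
    {M : K →L[ℝ] K} {c₀ c₁ : ℝ} (hc₀ : 0 < c₀) (hc₁ : 0 < c₁)
    (hMc : ∀ g, c₁ * ‖g‖ ^ 2 ≤ inner ℝ (M g) g) (hMs : ∀ g h, inner ℝ (M g) h = inner ℝ (M h) g)
    {N : K →L[ℝ] H} (hN : ∀ w, inner ℝ (N (P w)) (J w) = 0) :
    ∃ s : V →L[ℝ] V →L[ℝ] ℝ, IsSkewPerturbedForm J s (N.comp P) (min c₁ c₀) ∧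
      ∀ w z, s w z = inner ℝ (M (P w)) (P z) + c₀ * inner ℝ (J w) (J z) := by
  refine ⟨(realInnerL K).bilinearComp (M.comp P) P + c₀ • (realInnerL H).bilinearComp J J,
    ⟨lt_min hc₁ hc₀, fun w => ?_, fun w z => ?_, hN, hJ⟩, fun w z => rfl⟩
  · change _ ≤ inner ℝ (M (P w)) (P w) + c₀ * inner ℝ (J w) (J w)
    rw [real_inner_self_eq_norm_sq, hnorm, mul_add]
    have h1 := hMc (P w)
    have h2 : min c₁ c₀ * ‖J w‖ ^ 2 ≤ c₀ * ‖J w‖ ^ 2 :=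
      mul_le_mul_of_nonneg_right (min_le_right _ _) (sq_nonneg _)
    have h3 : min c₁ c₀ * ‖P w‖ ^ 2 ≤ c₁ * ‖P w‖ ^ 2 :=
      mul_le_mul_of_nonneg_right (min_le_left _ _) (sq_nonneg _)
    linarith
  · change inner ℝ (M (P w)) (P z) + c₀ * inner ℝ (J w) (J z)
      = inner ℝ (M (P z)) (P w) + c₀ * inner ℝ (J z) (J w)
    rw [hMs, real_inner_comm (J z) (J w)]

/-! ### The Dirichlet form on H¹₀(Ω). -/

section Sobolev

variable {d : ℕ} {Ω : Set (Space d)}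

instance : CompleteSpace (H10 Ω) :=
  inferInstanceAs (CompleteSpace (testPairs Ω).topologicalClosure)

/-- The inclusion `H¹₀(Ω) → L²(Ω)`. -/
noncomputable def H10.incl (Ω : Set (Space d)) : H10 Ω →L[ℝ] L2 Ω :=
  (WithLp.fstL 2 ℝ _ _).comp (H10 Ω).subtypeL

/-- The weak gradient `H¹₀(Ω) → L²(Ω; ℝ^d)`. -/
noncomputable def H10.grad (Ω : Set (Space d)) :
    H10 Ω →L[ℝ] Lp (Space d) 2 (volume.restrict Ω) :=
  (WithLp.sndL 2 ℝ _ _).comp (H10 Ω).subtypeL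

theorem H10.norm_sq (w : H10 Ω) : ‖w‖ ^ 2 = ‖H10.incl Ω w‖ ^ 2 + ‖H10.grad Ω w‖ ^ 2 :=
  WithLp.prod_norm_sq_eq_of_L2 (w : H1Ambient Ω)

theorem IsTestFunction.exists_mem_H10 {φ : Space d → ℝ} (hφ : IsTestFunction Ω φ) :
    ∃ w : H10 Ω, H10.incl Ω w =ᵐ[volume.restrict Ω] φ := by
  have h1 : MemLp φ 2 (volume.restrict Ω) :=
    (hφ.smooth.continuous.memLp_of_hasCompactSupport (μ := volume) hφ.compact).restrict Ω
  have hc : Continuous (gradient φ) :=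
    (InnerProductSpace.toDual ℝ (Space d)).symm.continuous.comp
      (hφ.smooth.continuous_fderiv (by simp))
  have hs : HasCompactSupport (gradient φ) :=
    (hφ.compact.fderiv (𝕜 := ℝ)).comp_left (g := (InnerProductSpace.toDual ℝ (Space d)).symm)
      (map_zero _)
  have h2 : MemLp (gradient φ) 2 (volume.restrict Ω) :=
    (hc.memLp_of_hasCompactSupport (μ := volume) hs).restrict Ω
  exact ⟨⟨WithLp.toLp 2 (h1.toLp, h2.toLp),
    (testPairs Ω).le_topologicalClosure ⟨φ, hφ, h1.coeFn_toLp, h2.coeFn_toLp⟩⟩, h1.coeFn_toLp⟩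

/-- A function orthogonal to all test functions vanishes a.e. on the open set Ω, by the fundamental
lemma of the calculus of variations. -/
theorem H10.denseRange_incl (hΩ : IsOpen Ω) : DenseRange (H10.incl Ω) := by
  have hr : range (H10.incl Ω) = ((H10.incl Ω).range : Set (L2 Ω)) := rfl
  rw [DenseRange, hr, Submodule.dense_iff_topologicalClosure_eq_top,
    Submodule.topologicalClosure_eq_top_iff, Submodule.eq_bot_iff]
  intro g hg
  have hg' : ∀ w, inner ℝ (H10.incl Ω w) g = 0 := fun w =>
    (Submodule.mem_orthogonal _ g).1 hg _ ⟨w, rfl⟩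
  have hloc : LocallyIntegrableOn g Ω volume := by
    exact locallyIntegrableOn_of_locallyIntegrable_restrict
      ((Lp.memLp g).locallyIntegrable (by norm_num))
  have h := hΩ.ae_eq_zero_of_integral_contDiff_smul_eq_zero hloc fun φ h1 h2 h3 => by
    obtain ⟨w, hw⟩ := (⟨h1, h2, h3⟩ : IsTestFunction Ω φ).exists_mem_H10
    have h4 := hg' w
    rw [L2.inner_def] at h4
    have h5 : ∫ x in Ω, φ x • g x = 0 := by
      rw [← h4]
      refine integral_congr_ae ?_
      filter_upwards [hw] with x hx
      rw [hx]
      simp [mul_comm]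
    rw [← h5, setIntegral_eq_integral_of_forall_compl_eq_zero]
    intro x hx
    rw [image_eq_zero_of_notMem_tsupport fun hx' => hx (h3 hx'), zero_smul]
  refine Lp.ext ?_
  filter_upwards [(ae_restrict_iff' hΩ.measurableSet).2 h, Lp.coeFn_zero ℝ 2 (volume.restrict Ω)]
    with x hx hx'
  rw [hx, hx']
  rfl

/-- A divergence free drift is skew on `H¹₀(Ω)`. -/
theorem IsDivergenceFree.inner_eq_zero {q : Space d → Space d} (hdiv : IsDivergenceFree Ω q)
    {M : Lp (Space d) 2 (volume.restrict Ω) →L[ℝ] L2 Ω}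
    (hM : ∀ g : Lp (Space d) 2 (volume.restrict Ω),
      M g =ᵐ[volume.restrict Ω] fun x => ∑ i, q x i * g x i) (w : H10 Ω) :
    inner ℝ (M (H10.grad Ω w)) (H10.incl Ω w) = 0 := by
  have hcl : IsClosed {w : H1Ambient Ω | inner ℝ (M w.snd) w.fst = (0 : ℝ)} := by
    refine isClosed_eq ?_ continuous_const
    exact (M.continuous.comp (WithLp.sndL 2 ℝ _ _).continuous).inner
      (WithLp.fstL 2 ℝ _ _).continuous
  refine closure_minimal ?_ hcl w.2
  rintro v ⟨φ, hφ, hv, hv'⟩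
  -- Testing ∇·q = 0 against φ² gives 2∫(q·∇φ)φ = 0; the identity passes to the closure.
  have hsq : IsTestFunction Ω (fun x => φ x * φ x) :=
    ⟨hφ.smooth.mul hφ.smooth, hφ.compact.mul_left,
      (tsupport_mul_subset_left (f := φ) (g := φ)).trans hφ.support⟩
  have h := hdiv _ hsq
  have e : ∫ x in Ω, ∑ i, q x i * gradient (fun x => φ x * φ x) x i
      = 2 * inner ℝ (M v.snd) v.fst := by
    rw [L2.inner_def, ← integral_const_mul]
    refine integral_congr_ae ?_
    filter_upwards [hv, hv', hM v.snd] with x h1 h2 h3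
    have hd : DifferentiableAt ℝ φ x := (hφ.smooth.differentiable (by simp)) x
    have hgrad : gradient (fun x => φ x * φ x) x = (2 * φ x) • gradient φ x := by
      have : fderiv ℝ (fun x => φ x * φ x) x = (2 * φ x) • fderiv ℝ φ x := by
        rw [fderiv_fun_mul hd hd, ← add_smul, two_mul]
      simp [gradient, this]
    rw [h1, h3, h2, hgrad]
    simp only [PiLp.smul_apply, smul_eq_mul, RCLike.inner_apply, conj_trivial, Finset.mul_sum]
    refine Finset.sum_congr rfl fun i _ => by ring
  rw [e] at h
  simpa using h

theorem form_eq {D : Space d → Matrix (Fin d) (Fin d) ℝ} {q : Space d → Space d} {c₀ : ℝ}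
    {M : Lp (Space d) 2 (volume.restrict Ω) →L[ℝ] Lp (Space d) 2 (volume.restrict Ω)}
    (hM : ∀ g h : Lp (Space d) 2 (volume.restrict Ω), (fun x => inner ℝ (M g x) (h x))
      =ᵐ[volume.restrict Ω] fun x => ∑ i, ∑ j, D x i j * g x j * h x i)
    {N : Lp (Space d) 2 (volume.restrict Ω) →L[ℝ] L2 Ω}
    (hN : ∀ g : Lp (Space d) 2 (volume.restrict Ω),
      N g =ᵐ[volume.restrict Ω] fun x => ∑ i, q x i * g x i) (w z : H1Ambient Ω) :
    form Ω D q c₀ w z = inner ℝ (M w.snd) z.snd + c₀ * inner ℝ w.fst z.fst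
      + inner ℝ (N w.snd) z.fst := by
  have i₁ := L2.integrable_inner (𝕜 := ℝ) (M w.snd) z.snd
  have i₂ := (L2.integrable_inner (𝕜 := ℝ) w.fst z.fst).const_mul c₀
  have i₃ := L2.integrable_inner (𝕜 := ℝ) (N w.snd) z.fst
  have e₁ := L2.inner_def (𝕜 := ℝ) (M w.snd) z.snd
  have e₂ := L2.inner_def (𝕜 := ℝ) w.fst z.fst
  have e₃ := L2.inner_def (𝕜 := ℝ) (N w.snd) z.fst
  rw [e₁, e₂, e₃, ← integral_const_mul, ← integral_add i₁ i₂]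
  refine Eq.trans (integral_congr_ae ?_) (integral_add (i₁.add i₂) i₃)
  filter_upwards [hM w.snd z.snd, hN w.snd] with x h1 h2
  rw [h1, h2]
  simp only [RCLike.inner_apply, conj_trivial]
  ring

set_option maxHeartbeats 400000 in
/-- The Dirichlet form splits into a symmetric coercive part and a skew drift, and `OperatorEq` is
membership in the graph of the associated operator. -/
theorem exists_isSkewPerturbedForm (hΩ : IsOpen Ω)
    {D : Space d → Matrix (Fin d) (Fin d) ℝ} {q : Space d → Space d}
    (hD : ∀ i j, MemLp (fun x => D x i j) ⊤ (volume.restrict Ω))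
    (hq : ∀ i, MemLp (fun x => q x i) ⊤ (volume.restrict Ω))
    (hDsymm : ∀ᵐ x ∂(volume.restrict Ω), (D x).IsSymm)
    {c₁ : ℝ} (hc₁ : 0 < c₁)
    (hell : ∀ᵐ x ∂(volume.restrict Ω), ∀ ξ : Space d,
      c₁ * ‖ξ‖ ^ 2 ≤ ∑ i, ∑ j, D x i j * ξ i * ξ j)
    (hdiv : IsDivergenceFree Ω q) {c₀ : ℝ} (hc₀ : 0 < c₀) :
    ∃ s B, IsSkewPerturbedForm (H10.incl Ω) s B (min c₁ c₀) ∧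
      ∀ u f, OperatorEq Ω D q c₀ u f ↔ (u, f) ∈ formGraph (H10.incl Ω) s B := by
  obtain ⟨M, hM⟩ := exists_matrix_operator hD
  obtain ⟨N, hN⟩ := exists_vector_operator hq
  obtain ⟨s, hf, hs⟩ := exists_isSkewPerturbedForm_of_gradient H10.norm_sq
    (H10.denseRange_incl hΩ) hc₀ hc₁ (matrix_operator_coercive hM hell)
    (matrix_operator_symm hM hDsymm) (hdiv.inner_eq_zero hN)
  have hform : ∀ w z : H10 Ω, form Ω D q c₀ w z
      = s w z + inner ℝ (N (H10.grad Ω w)) (H10.incl Ω z) := fun w z => by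
    rw [hs]
    exact form_eq hM hN w z
  refine ⟨s, N.comp (H10.grad Ω), hf, fun u f => ⟨?_, ?_⟩⟩
  · rintro ⟨w, hw, hu, h⟩
    exact ⟨⟨w, hw⟩, hu, fun z => (hform ⟨w, hw⟩ z).symm.trans (h z z.2)⟩
  · rintro ⟨w, hu, h⟩
    exact ⟨w, w.2, hu, fun z hz => (hform w ⟨z, hz⟩).trans (h ⟨z, hz⟩)⟩

end Sobolev

end ADR

/-! ### Generation and time regularity for the advection-diffusion operator. -/

theorem lemma4p2 {d : ℕ} (Ω : Set (ADR.Space d)) (hΩ : IsOpen Ω)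
    (D : ADR.Space d → Matrix (Fin d) (Fin d) ℝ) (q : ADR.Space d → ADR.Space d)
    (hD : ∀ i j, MemLp (fun x => D x i j) ⊤ (volume.restrict Ω))
    (hq : ∀ i, MemLp (fun x => q x i) ⊤ (volume.restrict Ω))
    (hDsymm : ∀ᵐ x ∂(volume.restrict Ω), (D x).IsSymm)
    (c₁ : ℝ) (hc₁ : 0 < c₁)
    (hell : ∀ᵐ x ∂(volume.restrict Ω), ∀ ξ : ADR.Space d,
      c₁ * ‖ξ‖ ^ 2 ≤ ∑ i, ∑ j, D x i j * ξ i * ξ j)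
    (hdiv : ADR.IsDivergenceFree Ω q)
    (c₀ : ℝ) (hc₀ : 0 < c₀) (T : ℝ) (hT : 0 < T) :
    (∃ S, ADR.IsSemigroupOf Ω D q c₀ S) ∧
    ∀ S, ADR.IsSemigroupOf Ω D q c₀ S →
      (∀ ε ∈ Ioo (0 : ℝ) (1 / 2), ∃ C : ℝ, 0 < C ∧
        ∀ (R : ℝ → ADR.L2 Ω → ADR.L2 Ω) (X₀ AX₀ : ADR.L2 Ω) (X : ℝ → ADR.L2 Ω),
          ADR.OperatorEq Ω D q c₀ X₀ AX₀ →
          ADR.IsMildSolution S R T X₀ X →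
          BddAbove ((fun s => ‖R s (X s)‖) '' Icc 0 T) →
          ∀ t₁ ∈ Icc 0 T, ∀ t₂ ∈ Icc 0 T, t₁ < t₂ →
            ‖X t₂ - X t₁‖ ≤ C * (t₂ - t₁) ^ (1 - ε) *
              (‖AX₀‖ + sSup ((fun s => ‖R s (X s)‖) '' Icc 0 T))) ∧
      (∀ L : ℝ, 0 ≤ L → ∃ C : ℝ, 0 < C ∧
        ∀ (R : ℝ → ADR.L2 Ω → ADR.L2 Ω) (X₀ AX₀ : ADR.L2 Ω) (X : ℝ → ADR.L2 Ω) (K : ℝ),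
          0 ≤ K →
          (∀ s ∈ Icc 0 T, ∀ t ∈ Icc 0 T, ∀ Y Z : ADR.L2 Ω,
            ‖R s Y - R t Z‖ ≤ L * ‖Y - Z‖ + K * |s - t|) →
          ADR.OperatorEq Ω D q c₀ X₀ AX₀ →
          ADR.IsMildSolution S R T X₀ X →
          ∀ t₁ ∈ Icc 0 T, ∀ t₂ ∈ Icc 0 T, t₁ < t₂ →
            ‖X t₂ - X t₁‖ ≤ C * (t₂ - t₁) *
              (‖AX₀‖ + sSup ((fun s => ‖R s (X s)‖) '' Icc 0 T) + K)) := by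
  obtain ⟨s, B, hf, hop⟩ := ADR.exists_isSkewPerturbedForm hΩ hD hq hDsymm hc₁ hell hdiv hc₀
  have hG := hf.isMAccretive
  refine ⟨?_, fun S hS => ?_⟩
  · obtain ⟨S, hS, hgen⟩ := hG.exists_semigroup
    exact ⟨S, hS, fun u f => (hop u f).trans (hgen u f)⟩
  have hS' : ADR.IsAccretiveSemigroup (ADR.formGraph (ADR.H10.incl Ω) s B) S :=
    ⟨hS.semigroup, hG.accretive, hG.dense, fun u f => (hop u f).symm.trans (hS.generator u f)⟩
  refine ⟨fun ε hε => ?_, fun L hL => ?_⟩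
  · obtain ⟨C, hC, hsm⟩ := hf.norm_semigroup_sub_le hS' T
    have hε0 := hε.1
    refine ⟨T ^ ε * (1 + (2 + C) / ε), by positivity, fun R X₀ AX₀ X hX₀ hX hbdd t₁ ht₁ t₂ ht₂ h =>
      ADR.norm_mild_sub_le_rpow hS' hC hsm hε0 (by linarith [hε.2]) ((hop _ _).1 hX₀) hX
        (fun r hr => le_csSup hbdd ⟨r, hr, rfl⟩) ht₁ ht₂ h⟩
  · refine ⟨(1 + T) * Real.exp (L * T), by positivity,
      fun R X₀ AX₀ X K hK hR hX₀ hX t₁ ht₁ t₂ ht₂ h =>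
      ADR.norm_mild_sub_le hS' hL hK hR ((hop _ _).1 hX₀) hX
        (fun r hr => le_csSup (hX.bddAbove_reaction hR) ⟨r, hr, rfl⟩) ht₁ ht₂ h⟩
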